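/- Let $R$ be a commutative ring and let $\widehat{\mathsf{PL}}_R=\prod_{n\ge 1}\mathsf{PL}_{n,R}$ be the completed free pre-Lie algebra on one generator over $R$: here $\mathsf{PL}_{n,R}$ is the free $R$-module on the isomorphism classes of (unlabelled, non-planar) rooted trees with $n$ vertices, and the pre-Lie product is the continuous bilinear extension of $$S\curvearrowleft T=\sum_{v\in \mathrm{Vert}(S)} S\circ_v T ,$$ where $S\circ_v T$ is the rooted tree obtained from $S\sqcup T$ by adding an edge from the root of $T$ to the vertex $v$ (the root of $S$ remaining the root). Let $\bullet$ be the rooted tree with one vertex. If $R$ is a $\mathbb{Q}$-algebra, $A,B\in\widehat{\mathsf{PL}}_R$ and $f(x)=\sum_{k\ge0} f_kx^k\in\mathbb{Q}[[x]]$, let $$A\curvearrowleft f(B)=\sum_{k\ge 0} f_k\,\bigl(\cdots((A\curvearrowleft B)\curvearrowleft B)\cdots\bigr)\curvearrowleft B\qquad(k\text{ copies of }B\text{ in the }k\text{th term})$$ be the right action on $A$ of the element $f(B)$ of the completed enveloping algebra. For $A=\sum_{n\ge1}A_n$ with $A_n$ homogeneous of degree $n$ and $q\in R$, let $A[q]=\sum_{n\ge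 1}q^nA_n$. There is a unique $\Omega\in\widehat{\mathsf{PL}}_{\mathbb{Q}}$ (the pre-Lie logarithm, also called $\log^*$) such that $$\bullet\curvearrowleft\frac{\Omega}{\exp(\Omega)-1}=\Omega ,$$ and there is a unique $\Omega_q\in\widehat{\mathsf{PL}}_{\mathbb{Q}(q)}$, with $q$ an indeterminate, such that $$\Omega_q[q]\curvearrowleft(\exp(\Omega)-1)+\Omega_q[q]-\Omega_q=\bullet\curvearrowleft\Omega_q+(q-1)\,\bullet .$$ The series $\Omega_q$ is regular at $q=1$ and $\Omega_{q=1}=\Omega$: for every rooted tree $T$, the coefficient of $T$ in $\Omega_q$ is a rational function in $\mathbb{Q}(q)$ without pole at $q=1$, and its value at $q=1$ is the coefficient of $T$ in $\Omega$. -/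

import Mathlib

/-- Finite planar (ordered) rooted trees: a root with an ordered list of subtrees on top of it. -/
inductive PlanarTree : Type where
  | node : List PlanarTree → PlanarTree

namespace PlanarTree

mutual
/-- The number of vertices. -/
def size : PlanarTree → ℕ
  | node l => sizeList l + 1
/-- The total number of vertices of a list of trees. -/
def sizeList : List PlanarTree → ℕ
  | [] => 0
  | t :: l => size t + sizeList l
end

mutual
/-- `grafts s t` lists the trees obtained from the disjoint union of `s` and `t` by adding an edge
from the root of `t` to a vertex of `s`; there is one entry for each vertex of `s`. -/
def grafts : PlanarTree → PlanarTree → List PlanarTree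
  | node l, t => node (t :: l) :: (graftsList l t).map node
/-- All the ways of grafting `t` on a vertex of one member of a list of trees. -/
def graftsList : List PlanarTree → PlanarTree → List (List PlanarTree)
  | [], _ => []
  | s :: l, t => (grafts s t).map (fun s' => s' :: l) ++ (graftsList l t).map (fun l' => s :: l')
end

/-- One elementary reordering: permute the subtrees above some vertex. -/
inductive Reorder : PlanarTree → PlanarTree → Prop where
  | perm {l l' : List PlanarTree} : l.Perm l' → Reorder (node l) (node l')
  | child {s s' : PlanarTree} (l : List PlanarTree) :
      Reorder s s' → Reorder (node (s :: l)) (node (s' :: l))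

end PlanarTree

/-- (Unlabelled, non-planar) rooted trees up to isomorphism: planar rooted trees up to reordering
of the subtrees above each vertex. -/
def RTree : Type := Quot PlanarTree.Reorder

namespace PlanarTree

theorem sizeList_perm {l l' : List PlanarTree} (h : l.Perm l') : sizeList l = sizeList l' := by
  induction h with
  | nil => rfl
  | cons x _ ih => simp only [sizeList, ih]
  | swap x y l => simp only [sizeList]; omega
  | trans _ _ ih1 ih2 => exact ih1.trans ih2

theorem size_reorder {s s' : PlanarTree} (h : Reorder s s') : size s = size s' := by
  induction h with
  | perm h => simp only [size, sizeList_perm h]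
  | child l _ ih => simp only [size, sizeList, ih]

theorem size_pos (t : PlanarTree) : 0 < size t := by
  cases t; simp only [size]; omega

theorem length_le_sizeList (l : List PlanarTree) : l.length ≤ sizeList l := by
  induction l with
  | nil => simp
  | cons t l ih => have := size_pos t; simp only [sizeList, List.length_cons]; omega

theorem size_le_sizeList {l : List PlanarTree} {t : PlanarTree} (h : t ∈ l) :
    size t ≤ sizeList l := by
  induction l with
  | nil => simp at h
  | cons s l ih =>
    simp only [sizeList]
    rcases List.mem_cons.1 h with rfl | h
    · omega
    · have := ih h; omega

theorem finite_size_le (n : ℕ) : {t : PlanarTree | size t ≤ n}.Finite := by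
  induction n with
  | zero =>
    refine Set.Finite.subset Set.finite_empty fun t ht => ?_
    have := size_pos t
    simp only [Set.mem_ofPred_eq] at ht
    omega
  | succ n ih =>
    have hfin : {l : List PlanarTree | l.length < n + 1 ∧
        ∀ t ∈ l, t ∈ {t : PlanarTree | size t ≤ n}}.Finite := by
      have := ih.to_subtype
      refine ((List.finite_length_le {t : PlanarTree | size t ≤ n} n).image
        (List.map Subtype.val)).subset ?_
      rintro l ⟨hl, hm⟩
      refine ⟨l.attach.map fun x => ⟨x.1, hm x.1 x.2⟩, ?_, ?_⟩
      · rw [Set.mem_ofPred_eq, List.length_map, List.length_attach]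
        exact Nat.lt_succ_iff.1 hl
      · simp [List.map_map, Function.comp_def]
    refine (hfin.image node).subset ?_
    rintro ⟨l⟩ ht
    simp only [Set.mem_ofPred_eq, size] at ht
    refine ⟨l, ⟨?_, fun t h => ?_⟩, rfl⟩
    · have := length_le_sizeList l; omega
    · have := size_le_sizeList h; simp only [Set.mem_ofPred_eq]; omega

end PlanarTree

namespace RTree

/-- The isomorphism class of a planar tree. -/
def mk (t : PlanarTree) : RTree := Quot.mk _ t

/-- The number `#T` of vertices of a rooted tree. -/
def size : RTree → ℕ := Quot.lift PlanarTree.size fun _ _ h => PlanarTree.size_reorder h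

/-- The rooted tree with one vertex. -/
def single : RTree := mk (PlanarTree.node [])

theorem finite_size_eq (n : ℕ) : {T : RTree | size T = n}.Finite := by
  refine ((PlanarTree.finite_size_le n).image mk).subset ?_
  rintro ⟨t⟩ ht
  exact ⟨t, le_of_eq ht, rfl⟩

/-- The finite set of rooted trees with `n` vertices. -/
noncomputable def ofSize (n : ℕ) : Finset RTree := (finite_size_eq n).toFinset

theorem mk_node_congr {l l' : List PlanarTree}
    (h : (l.map mk : Multiset RTree) = (l'.map mk : Multiset RTree)) :
    mk (PlanarTree.node l) = mk (PlanarTree.node l') := by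
  have key : ∀ m : List PlanarTree, ∀ a b : List PlanarTree, a.map mk = b.map mk →
      mk (PlanarTree.node (a ++ m)) = mk (PlanarTree.node (b ++ m)) := by
    have perm : ∀ {a b : List PlanarTree}, a.Perm b →
        mk (PlanarTree.node a) = mk (PlanarTree.node b) :=
      fun h => Quot.sound (PlanarTree.Reorder.perm h)
    have head : ∀ (s s' : PlanarTree) (l : List PlanarTree), mk s = mk s' →
        mk (PlanarTree.node (s :: l)) = mk (PlanarTree.node (s' :: l)) := by
      intro s s' l h
      have h' := Quot.eqvGen_exact h
      clear h
      induction h' with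
      | rel _ _ h => exact Quot.sound (PlanarTree.Reorder.child l h)
      | refl _ => rfl
      | symm _ _ _ ih => exact ih.symm
      | trans _ _ _ _ _ ih1 ih2 => exact ih1.trans ih2
    intro m a
    induction a generalizing m with
    | nil =>
      intro b hb
      have : b = [] := by simpa using hb.symm
      rw [this]
    | cons s a ih =>
      intro b hb
      cases b with
      | nil => simp at hb
      | cons s' b =>
        simp only [List.map_cons, List.cons.injEq] at hb
        have h1 := ih (s :: m) b hb.2
        calc mk (PlanarTree.node (s :: a ++ m))
            = mk (PlanarTree.node (a ++ s :: m)) := perm List.perm_middle.symm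
          _ = mk (PlanarTree.node (b ++ s :: m)) := h1
          _ = mk (PlanarTree.node (s :: (b ++ m))) := perm List.perm_middle
          _ = mk (PlanarTree.node (s' :: (b ++ m))) := head _ _ _ hb.1
  have hp : (l.map mk).Perm (l'.map mk) := Multiset.coe_eq_coe.1 h
  obtain ⟨c, hc, hc'⟩ : ∃ c : List PlanarTree, l.Perm c ∧ c.map mk = l'.map mk := by
    have h2 : Relation.Comp (· = List.map mk ·) (fun a b : List PlanarTree => a.Perm b)
        (l'.map mk) l := by
      rw [List.eq_map_comp_perm]
      exact hp.symm
    obtain ⟨c, h3, h4⟩ := h2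
    exact ⟨c, h4.symm, h3.symm⟩
  calc mk (PlanarTree.node l) = mk (PlanarTree.node c) :=
        Quot.sound (PlanarTree.Reorder.perm hc)
    _ = mk (PlanarTree.node l') := by simpa using key [] c l' hc'

/-- A planar representative of a rooted tree. -/
noncomputable def rep (T : RTree) : PlanarTree := Quot.out T

theorem mk_rep (T : RTree) : mk T.rep = T := Quot.out_eq T

/-- The rooted tree whose root carries the given multiset of rooted trees. -/
noncomputable def node (m : Multiset RTree) : RTree :=
  mk (PlanarTree.node (m.toList.map rep))

theorem mk_node (l : List PlanarTree) :
    mk (PlanarTree.node l) = node (l.map mk : Multiset RTree) := by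
  apply mk_node_congr
  have : mk ∘ rep = id := funext mk_rep
  rw [List.map_map, this, List.map_id, Multiset.coe_toList]

/-- The multiset of classes of the trees in `PlanarTree.grafts s t`. -/
def graftsClass (s t : PlanarTree) : Multiset RTree := ((PlanarTree.grafts s t).map mk : List _)

/-- The multiset of classes of the forests in `PlanarTree.graftsList l t`. -/
def graftsListClass (l : List PlanarTree) (t : PlanarTree) : Multiset (Multiset RTree) :=
  ((PlanarTree.graftsList l t).map fun l' => (l'.map mk : Multiset RTree) : List _)

theorem graftsClass_node (l : List PlanarTree) (t : PlanarTree) :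
    graftsClass (PlanarTree.node l) t =
      node (mk t ::ₘ (l.map mk : Multiset RTree)) ::ₘ (graftsListClass l t).map node := by
  simp [graftsClass, graftsListClass, PlanarTree.grafts, mk_node, Function.comp_def]

theorem graftsListClass_cons (s : PlanarTree) (l : List PlanarTree) (t : PlanarTree) :
    graftsListClass (s :: l) t =
      (graftsClass s t).map (fun T => T ::ₘ (l.map mk : Multiset RTree)) +
        (graftsListClass l t).map (fun m => mk s ::ₘ m) := by
  simp [graftsClass, graftsListClass, PlanarTree.graftsList, Function.comp_def]

theorem graftsListClass_perm {l l' : List PlanarTree} (h : l.Perm l') (t : PlanarTree) :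
    graftsListClass l t = graftsListClass l' t := by
  induction h with
  | nil => rfl
  | cons s h ih =>
    have : (List.map mk _ : Multiset RTree) = List.map mk _ :=
      Multiset.coe_eq_coe.2 (h.map mk)
    rw [graftsListClass_cons, graftsListClass_cons, ih, this]
  | swap a b l =>
    simp only [graftsListClass_cons, Multiset.map_add, Multiset.map_map, Function.comp_def,
      List.map_cons, ← Multiset.cons_coe]
    rw [← add_assoc, ← add_assoc]
    congr 1
    · rw [add_comm]
      congr 1 <;> exact Multiset.map_congr rfl fun T _ => Multiset.cons_swap _ _ _
    · exact Multiset.map_congr rfl fun m _ => Multiset.cons_swap _ _ _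
  | trans _ _ ih1 ih2 => exact ih1.trans ih2

theorem graftsClass_left {s s' : PlanarTree} (h : PlanarTree.Reorder s s') (t : PlanarTree) :
    graftsClass s t = graftsClass s' t := by
  induction h with
  | @perm l l' h =>
    have : (l.map mk : Multiset RTree) = (l'.map mk : Multiset RTree) :=
      Multiset.coe_eq_coe.2 (h.map mk)
    rw [graftsClass_node, graftsClass_node, graftsListClass_perm h, this]
  | @child s s' l h ih =>
    have : mk s = mk s' := Quot.sound h
    simp only [graftsClass_node, graftsListClass_cons, ih, List.map_cons, this]

mutual
theorem graftsClass_right {t t' : PlanarTree} (h : mk t = mk t') :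
    ∀ s : PlanarTree, graftsClass s t = graftsClass s t'
  | PlanarTree.node l => by rw [graftsClass_node, graftsClass_node, graftsListClass_right h l, h]
theorem graftsListClass_right {t t' : PlanarTree} (h : mk t = mk t') :
    ∀ l : List PlanarTree, graftsListClass l t = graftsListClass l t'
  | [] => by simp [graftsListClass, PlanarTree.graftsList]
  | s :: l => by
    rw [graftsListClass_cons, graftsListClass_cons, graftsClass_right h s,
      graftsListClass_right h l]
end

/-- The multiset of rooted trees obtained from the disjoint union of `S` and `T` by adding an edge
from the root of `T` to a vertex of `S`, one for each vertex of `S`. Their sum is the pre-Lie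
product of the basis elements `S` and `T`. -/
def grafts (S T : RTree) : Multiset RTree :=
  Quot.liftOn₂ S T graftsClass (fun _ _ _ h => graftsClass_right (Quot.sound h) _)
    (fun _ _ _ h => graftsClass_left h _)

end RTree

/-- The completed free pre-Lie algebra on one generator over `R`, i.e. the product over `n ≥ 1` of
the free modules on the finite sets of rooted trees with `n` vertices: an element is an arbitrary
family of coefficients indexed by rooted trees. -/
abbrev PLHat (R : Type*) : Type _ := RTree → R

namespace PLHat

open Classical in
/-- The basis element given by the rooted tree with one vertex. -/
noncomputable def bullet (R : Type*) [CommRing R] : PLHat R := Pi.single RTree.single 1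

open Classical in
/-- The pre-Lie product `A ↶ B`: the coefficient of `T` is the sum of `A T₁ * B T₂` over all ways
of obtaining `T` by grafting a tree `T₂` on a vertex of a tree `T₁`. -/
noncomputable def preLie {R : Type*} [CommRing R] (A B : PLHat R) : PLHat R := fun T =>
  ∑ p ∈ Finset.HasAntidiagonal.antidiagonal T.size, ∑ T₁ ∈ RTree.ofSize p.1, ∑ T₂ ∈ RTree.ofSize p.2,
    ((RTree.grafts T₁ T₂).count T : R) * (A T₁ * B T₂)

/-- The `k`-fold right action `(…((A ↶ B) ↶ B) …) ↶ B`, i.e. the action on `A` of the power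
`B ⋆ … ⋆ B` in the completed enveloping algebra. -/
noncomputable def actPow {R : Type*} [CommRing R] (A B : PLHat R) : ℕ → PLHat R
  | 0 => A
  | k + 1 => preLie (actPow A B k) B

/-- All terms of `(…((A ↶ B) ↶ B) …) ↶ B` (with `k` letters `B`) have more than `k` vertices. -/
theorem actPow_eq_zero {R : Type*} [CommRing R] (A B : PLHat R) (k : ℕ) (T : RTree)
    (h : T.size ≤ k) : actPow A B k T = 0 := by
  have pos : ∀ T : RTree, 0 < T.size := by rintro ⟨t⟩; exact PlanarTree.size_pos t
  induction k generalizing T with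
  | zero => have := pos T; omega
  | succ k ih =>
    rw [actPow, preLie]
    refine Finset.sum_eq_zero fun p hp => Finset.sum_eq_zero fun T₁ h₁ =>
      Finset.sum_eq_zero fun T₂ h₂ => ?_
    simp only [RTree.ofSize, Set.Finite.mem_toFinset, Set.mem_ofPred_eq] at h₁ h₂
    have := Finset.HasAntidiagonal.mem_antidiagonal.1 hp
    have := pos T₂
    rw [ih T₁ (by omega)]
    simp

/-- The right action `A ↶ f(B)` of the element `f(B) = ∑ fₖ B ⋆ … ⋆ B` of the completed enveloping
algebra, for a formal power series `f`, i.e. `∑ₖ fₖ (…((A ↶ B) ↶ B) …) ↶ B`. The coefficient of a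
tree `T` only involves the terms with `k < #T`, the others being zero by `actPow_eq_zero`. -/
noncomputable def act {R : Type*} [CommRing R] [Algebra ℚ R] (A : PLHat R) (f : PowerSeries ℚ)
    (B : PLHat R) : PLHat R := fun T =>
  ∑ k ∈ Finset.range T.size, algebraMap ℚ R (PowerSeries.coeff k f) * actPow A B k T

/-- The `q`-shift `A[q] = ∑ qⁿ Aₙ`, where `Aₙ` is the homogeneous component of degree `n`. -/
def shift {R : Type*} [CommRing R] (q : R) (A : PLHat R) : PLHat R := fun T => q ^ T.size * A T

/-- Extension of scalars from `ℚ` to `ℚ(q)`. -/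
noncomputable def toRatFunc (A : PLHat ℚ) : PLHat (RatFunc ℚ) := fun T => RatFunc.C (A T)

/-- The equation `• ↶ (Ω / (exp Ω - 1)) = Ω` that characterizes the classical series `Ω`. The power
series `x / (exp x - 1)` is `bernoulliPowerSeries`, see
`bernoulliPowerSeries_mul_exp_sub_one`. -/
def IsOmega (Om : PLHat ℚ) : Prop := act (bullet ℚ) (bernoulliPowerSeries ℚ) Om = Om

/-- The equation `Ω_q[q] ↶ (exp Ω - 1) + Ω_q[q] - Ω_q = • ↶ Ω_q + (q - 1) •` that characterizes the
series `Ω_q`, given the classical series `Ω`. -/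
def IsOmegaQ (Om : PLHat ℚ) (Omq : PLHat (RatFunc ℚ)) : Prop :=
  act (shift RatFunc.X Omq) (PowerSeries.exp ℚ - 1) (toRatFunc Om) + shift RatFunc.X Omq - Omq =
    preLie (bullet (RatFunc ℚ)) Omq + (RatFunc.X - 1 : RatFunc ℚ) • bullet (RatFunc ℚ)

end PLHat

open scoped Classical

-- Rooted trees as forests under a root, and the multiplicities of graftings.

namespace RTree

-- Write B₊(exp P) for `nodeExp P`. The link between Ω_q and Ω is a series P of trees whose
-- coefficients are polynomials in a variable Y, with P(0) = 0 and P(qY + 1) - P(Y) = (1 + (q - 1)Y)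
-- B₊(exp P(Y)) (`IsEulerOrbit`). Its linear coefficient in Y is Ω_q when q is the indeterminate and
-- Ω when q = 1. Since P can be built over the rational functions without pole at 1, specializing P
-- at q = 1 gives the theorem.
--
-- Grafting acts on B₊(exp z) as a derivation, apart from the grafting on the new root
-- (`preLie_nodeExp_node`). Hence B₊ exp turns the affine flow z' = z ↶ B + B into the linear flow
-- w' = w ↶ B. If B ↶ (exp B - 1)/B = •, an inverted form of the equation of Ω, comparison at time 1
-- yields B₊(exp A) ↶ exp B = B₊(exp(A ↶ exp B + •)) (`act_nodeExp`). Consequently P(qY + 1) and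
-- P[q] ↶ exp Ω + • satisfy the same difference equation with the same initial value, so they
-- coincide; the coefficient of Y in this identity is the equation of Ω_q
-- (`IsEulerOrbit.coeff_one_spec`). For q = 1 the affine flow of Ω started at 0 is itself the orbit
-- (`isEulerOrbit_affineFlow`).
--
-- Orbits are unique because a polynomial invariant under Y ↦ qY + 1 is constant on the infinitely
-- many q-integers (`eq_zero_of_qStep_eq`). They exist as soon as the q-integers 1 + q + … + qⁿ are
-- invertible (`exists_qStep_sub_eq`), which holds among the rational functions without pole at 1,
-- where they take the nonzero value n + 1.

theorem size_pos (T : RTree) : 0 < T.size := by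
  rcases T with ⟨t⟩
  exact PlanarTree.size_pos t

/-- The multiset of subtrees carried by the root. -/
def children : RTree → Multiset RTree :=
  Quot.lift (fun t => match t with | PlanarTree.node l => (l.map mk : Multiset RTree)) (by
    intro a b h
    cases h with
    | perm h => exact Multiset.coe_eq_coe.2 (h.map mk)
    | child l h =>
      have : mk _ = mk _ := Quot.sound h
      simp [this])

theorem children_mk_node (l : List PlanarTree) :
    children (mk (PlanarTree.node l)) = (l.map mk : Multiset RTree) := rfl

theorem map_mk_rep (m : Multiset RTree) :
    ((m.toList.map rep).map mk : Multiset RTree) = m := by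
  have : mk ∘ rep = id := funext mk_rep
  rw [List.map_map, this, List.map_id, Multiset.coe_toList]

@[simp] theorem children_node (m : Multiset RTree) : children (node m) = m := by
  rw [node, children_mk_node, map_mk_rep]

@[simp] theorem node_children (T : RTree) : node T.children = T := by
  rcases T with ⟨⟨l⟩⟩
  exact (mk_node l).symm

theorem node_injective : Function.Injective node :=
  Function.LeftInverse.injective children_node

theorem single_eq_node : single = node 0 := by
  rw [single, mk_node]
  rfl

theorem children_single : children single = 0 := rfl

theorem size_mk_node (l : List PlanarTree) :
    size (mk (PlanarTree.node l)) = ((l.map mk : Multiset RTree).map size).sum + 1 := by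
  change PlanarTree.sizeList l + 1 = _
  congr 1
  induction l with
  | nil => rfl
  | cons s l ih =>
    rw [PlanarTree.sizeList, ih]
    rfl

theorem size_node (m : Multiset RTree) : (node m).size = (m.map size).sum + 1 := by
  rw [node, size_mk_node, map_mk_rep]

theorem size_lt_of_mem {m : Multiset RTree} {T : RTree} (h : T ∈ m) :
    T.size < (node m).size := by
  obtain ⟨m', rfl⟩ := Multiset.exists_cons_of_mem h
  rw [size_node, Multiset.map_cons, Multiset.sum_cons]
  omega

theorem size_lt_of_mem_children {S T : RTree} (h : S ∈ T.children) : S.size < T.size := by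
  have := size_lt_of_mem h
  rwa [node_children] at this

/-- The forests obtained by grafting `t` on a vertex of a member of the forest `m`. -/
noncomputable def graftsForest (m : Multiset RTree) (t : RTree) : Multiset (Multiset RTree) :=
  m.bind fun S => (grafts S t).map fun T => T ::ₘ m.erase S

theorem graftsListClass_eq (l : List PlanarTree) (t : PlanarTree) :
    graftsListClass l t = graftsForest (l.map mk : Multiset RTree) (mk t) := by
  induction l with
  | nil => simp [graftsListClass, graftsForest, PlanarTree.graftsList]
  | cons s l ih =>
    rw [graftsListClass_cons, ih, graftsForest, graftsForest, List.map_cons, ← Multiset.cons_coe,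
      Multiset.cons_bind, Multiset.erase_cons_head, Multiset.map_bind]
    congr 1
    refine Multiset.bind_congr fun S hS => ?_
    rw [Multiset.map_map]
    refine Multiset.map_congr rfl fun T _ => ?_
    rw [Function.comp_apply, Multiset.cons_swap]
    congr 1
    by_cases h : mk s = S
    · subst h
      rw [Multiset.erase_cons_head, Multiset.cons_erase hS]
    · rw [Multiset.erase_cons_tail _ h]

theorem grafts_node (m : Multiset RTree) (t : RTree) :
    grafts (node m) t = node (t ::ₘ m) ::ₘ (graftsForest m t).map node := by
  rcases t with ⟨t⟩
  change grafts (mk _) (mk t) = node (mk t ::ₘ m) ::ₘ (graftsForest m (mk t)).map node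
  change graftsClass _ t = _
  rw [graftsClass_node, graftsListClass_eq, map_mk_rep]

theorem size_of_mem_grafts {S t T : RTree} (h : T ∈ grafts S t) : T.size = S.size + t.size := by
  induction hn : S.size using Nat.strong_induction_on generalizing S T with
  | _ n ih =>
    rw [← node_children S, grafts_node, Multiset.mem_cons] at h
    rcases h with rfl | h
    · rw [size_node, ← hn]
      conv_rhs => rw [← node_children S, size_node]
      rw [Multiset.map_cons, Multiset.sum_cons]
      omega
    · obtain ⟨m, hm, rfl⟩ := Multiset.mem_map.1 h
      obtain ⟨c, hc, hm⟩ := Multiset.mem_bind.1 hm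
      obtain ⟨T, hT, rfl⟩ := Multiset.mem_map.1 hm
      have h1 := ih c.size (hn ▸ size_lt_of_mem_children hc) hT rfl
      have h2 : S.size = c.size + ((S.children.erase c).map size).sum + 1 := by
        conv_lhs => rw [← node_children S, size_node, ← Multiset.cons_erase hc]
        rw [Multiset.map_cons, Multiset.sum_cons]
      rw [size_node, Multiset.map_cons, Multiset.sum_cons, h1]
      omega

theorem count_grafts_eq_zero {S t T : RTree} (h : T.size ≠ S.size + t.size) :
    (grafts S t).count T = 0 :=
  Multiset.count_eq_zero.2 fun hT => h (size_of_mem_grafts hT)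

/-- At most one T in m can satisfy the condition, since then m = T ::ₘ e. The sum form is kept so
that it can be exchanged with other sums. -/
theorem count_map_cons (M : Multiset RTree) (e m : Multiset RTree) :
    (M.map fun T => T ::ₘ e).count m =
      ∑ T ∈ m.toFinset, if e = m.erase T then M.count T else 0 := by
  induction M using Multiset.induction_on with
  | empty => simp
  | cons S M ih =>
    rw [Multiset.map_cons, Multiset.count_cons, ih]
    have : ∀ T ∈ m.toFinset, (if e = m.erase T then (S ::ₘ M).count T else 0) =
        (if e = m.erase T then M.count T else 0) + if T = S then (if m = S ::ₘ e then 1 else 0)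
          else 0 := by
      intro T hT
      rw [Multiset.mem_toFinset] at hT
      rw [Multiset.count_cons]
      by_cases h : e = m.erase T
      · rw [if_pos h, if_pos h]
        by_cases h' : T = S
        · subst h'
          rw [h, Multiset.cons_erase hT]
          simp
        · simp [h']
      · rw [if_neg h, if_neg h]
        by_cases h' : T = S
        · subst h'
          rw [if_pos rfl, if_neg]
          rintro rfl
          simp at h
        · simp [h']
    rw [Finset.sum_congr rfl this, Finset.sum_add_distrib, Finset.sum_ite_eq']
    congr 1
    by_cases h : m = S ::ₘ e
    · simp [h]
    · simp [h]

theorem count_graftsForest (m m' : Multiset RTree) (t : RTree) :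
    (graftsForest m' t).count m = ∑ T ∈ m.toFinset, ∑ S ∈ m'.toFinset,
      if m'.erase S = m.erase T then m'.count S * (grafts S t).count T else 0 := by
  rw [graftsForest, Multiset.count_bind, Finset.sum_multiset_map_count, Finset.sum_comm]
  refine Finset.sum_congr rfl fun S _ => ?_
  rw [count_map_cons, Finset.smul_sum]
  refine Finset.sum_congr rfl fun T _ => ?_
  split_ifs <;> simp

theorem count_node_grafts (m : Multiset RTree) (S t : RTree) :
    (grafts S t).count (node m) =
      (if m = t ::ₘ S.children then 1 else 0) + (graftsForest S.children t).count m := by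
  conv_lhs => rw [← node_children S, grafts_node]
  rw [Multiset.count_cons, Multiset.count_map_eq_count' _ _ node_injective, add_comm]
  simp only [node_injective.eq_iff]

/-- The finite set of rooted trees with at most `n` vertices. -/
noncomputable def upTo (n : ℕ) : Finset RTree := (Finset.range (n + 1)).biUnion ofSize

theorem mem_ofSize {n : ℕ} {T : RTree} : T ∈ ofSize n ↔ T.size = n := by
  simp [ofSize]

theorem mem_upTo {n : ℕ} {T : RTree} : T ∈ upTo n ↔ T.size ≤ n := by
  simp [upTo, mem_ofSize]

end RTree

namespace PLHat

-- The exponential in the completed symmetric algebra of forests.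

section Exponential

variable {R : Type*} [CommRing R] [Algebra ℚ R]

/-- The coefficients of the exponential of `z` in the completed symmetric algebra, whose basis
elements are the forests. -/
noncomputable def expForest (z : PLHat R) (m : Multiset RTree) : R :=
  ∏ T ∈ m.toFinset, ((m.count T).factorial : ℚ)⁻¹ • z T ^ m.count T

theorem expForest_eq_prod (z : PLHat R) {m : Multiset RTree} {F : Finset RTree}
    (h : m.toFinset ⊆ F) :
    expForest z m = ∏ T ∈ F, ((m.count T).factorial : ℚ)⁻¹ • z T ^ m.count T := by
  refine Finset.prod_subset h fun T _ hT => ?_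
  rw [Multiset.mem_toFinset] at hT
  simp [Multiset.count_eq_zero.2 hT]

@[simp] theorem expForest_zero (z : PLHat R) : expForest z 0 = 1 := by simp [expForest]

theorem inv_factorial_succ_smul (n : ℕ) (x : R) :
    ((n : R) + 1) * (((n + 1).factorial : ℚ)⁻¹ • x) = ((n.factorial : ℚ)⁻¹ • x) := by
  have h : ((n : R) + 1) = algebraMap ℚ R (n + 1) := by simp
  rw [h, ← Algebra.smul_def, smul_smul]
  congr 1
  rw [Nat.factorial_succ]
  push_cast
  have : (n : ℚ) + 1 ≠ 0 := by positivity
  have : (n.factorial : ℚ) ≠ 0 := by positivity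
  field_simp

/-- Adding a copy of S changes only the factor of S, where 1/n! becomes 1/(n + 1)!. The left factor
is the number of copies of S in the larger forest, which is how it arises when graftings are
counted. -/
theorem expForest_cons (z : PLHat R) (S : RTree) (m : Multiset RTree) :
    ((m.count S : R) + 1) * expForest z (S ::ₘ m) = z S * expForest z m := by
  have hS : S ∈ (S ::ₘ m).toFinset := by simp
  have hm : m.toFinset ⊆ (S ::ₘ m).toFinset := by
    intro T
    simp only [Multiset.mem_toFinset, Multiset.mem_cons]
    exact Or.inr
  rw [expForest_eq_prod z hm, expForest, ← Finset.mul_prod_erase _ _ hS,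
    ← Finset.mul_prod_erase _ _ hS, ← mul_assoc, ← mul_assoc, Multiset.count_cons_self,
    inv_factorial_succ_smul, pow_succ', mul_smul_comm]
  congr 1
  refine Finset.prod_congr rfl fun T hT => ?_
  rw [Multiset.count_cons_of_ne (Finset.ne_of_mem_erase hT)]

theorem expForest_congr {z z' : PLHat R} {m : Multiset RTree} (h : ∀ T ∈ m, z T = z' T) :
    expForest z m = expForest z' m :=
  Finset.prod_congr rfl fun T hT => by rw [h T (Multiset.mem_toFinset.1 hT)]

theorem map_expForest {R' : Type*} [CommRing R'] [Algebra ℚ R'] (φ : R →+* R') (z : PLHat R)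
    (m : Multiset RTree) : φ (expForest z m) = expForest (φ ∘ z) m := by
  simp only [expForest, map_prod, Function.comp_apply, map_rat_smul φ, map_pow]

theorem expForest_shift (q : R) (z : PLHat R) (m : Multiset RTree) :
    expForest (shift q z) m = q ^ (m.map RTree.size).sum * expForest z m := by
  rw [Finset.sum_multiset_map_count, ← Finset.prod_pow_eq_pow_sum, expForest, expForest,
    ← Finset.prod_mul_distrib]
  refine Finset.prod_congr rfl fun T _ => ?_
  rw [shift, mul_pow, mul_smul_comm, ← pow_mul, smul_eq_mul, mul_comm T.size]

/-- This is (exp z)' = z' · exp z, read on the coefficient of a forest. -/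
theorem derivative_expForest (z : PLHat (Polynomial R)) (m : Multiset RTree) :
    Polynomial.derivative (expForest z m) =
      ∑ T ∈ m.toFinset, Polynomial.derivative (z T) * expForest z (m.erase T) := by
  rw [expForest, Polynomial.derivative_prod_finset]
  refine Finset.sum_congr rfl fun T hT => ?_
  have hsub : (m.erase T).toFinset ⊆ m.toFinset := by
    intro S
    simp only [Multiset.mem_toFinset]
    exact Multiset.mem_of_mem_erase
  obtain ⟨n, hn⟩ : ∃ n, m.count T = n + 1 :=
    Nat.exists_eq_succ_of_ne_zero (Multiset.count_ne_zero.2 (Multiset.mem_toFinset.1 hT))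
  rw [expForest_eq_prod z hsub, ← Finset.mul_prod_erase _ _ hT, Multiset.count_erase_self, hn,
    map_rat_smul (Polynomial.derivative (R := R)), Polynomial.derivative_pow_succ]
  have : ∏ S ∈ m.toFinset.erase T, ((m.count S).factorial : ℚ)⁻¹ • z S ^ m.count S =
      ∏ S ∈ m.toFinset.erase T,
        (((m.erase T).count S).factorial : ℚ)⁻¹ • z S ^ (m.erase T).count S :=
    Finset.prod_congr rfl fun S hS => by
      rw [Multiset.count_erase_of_ne (Finset.ne_of_mem_erase hS)]
  rw [this, Nat.add_sub_cancel, ← inv_factorial_succ_smul n (z T ^ n)]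
  simp only [Algebra.smul_def, map_add, map_natCast, map_one]
  ring

/-- The exponential of `z`, with all trees of each forest grafted on a new root. -/
noncomputable def nodeExp (z : PLHat R) : PLHat R := fun T => expForest z T.children

theorem nodeExp_node (z : PLHat R) (m : Multiset RTree) :
    nodeExp z (RTree.node m) = expForest z m := by
  rw [nodeExp, RTree.children_node]

theorem nodeExp_zero : nodeExp (0 : PLHat R) = bullet R := by
  funext T
  rw [nodeExp, bullet, Pi.single_apply]
  split_ifs with h
  · rw [h, RTree.children_single, expForest_zero]
  · have : T.children ≠ 0 := by
      intro h'
      rw [← T.node_children, h'] at h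
      exact h RTree.single_eq_node.symm
    obtain ⟨S, hS⟩ := Multiset.exists_mem_of_ne_zero this
    refine Finset.prod_eq_zero (Multiset.mem_toFinset.2 hS) ?_
    rw [Pi.zero_apply, zero_pow (Multiset.count_ne_zero.2 hS), smul_zero]

theorem map_nodeExp {R' : Type*} [CommRing R'] [Algebra ℚ R'] (φ : R →+* R') (z : PLHat R) :
    φ ∘ nodeExp z = nodeExp (φ ∘ z) :=
  funext fun _ => map_expForest φ z _

/-- The factor q accounts for the new root. -/
theorem shift_nodeExp (q : R) (z : PLHat R) :
    shift q (nodeExp z) = q • nodeExp (shift q z) := by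
  funext T
  rw [← T.node_children]
  simp only [shift, Pi.smul_apply, nodeExp_node]
  rw [RTree.size_node, expForest_shift, smul_eq_mul]
  ring

end Exponential

-- The pre-Lie product: finite sums, locality, linearity.

section PreLie

variable {R : Type*} [CommRing R]

/-- Grafting adds sizes, so the constraint on the sizes is already enforced by the multiplicity. A
rectangular index set independent of T makes it possible to exchange sums. -/
theorem preLie_eq_sum (A B : PLHat R) (T : RTree) {n : ℕ} (h : T.size ≤ n) :
    preLie A B T = ∑ T₁ ∈ RTree.upTo n, ∑ T₂ ∈ RTree.upTo n,
      ((RTree.grafts T₁ T₂).count T : R) * (A T₁ * B T₂) := by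
  have h1 : ∀ p ∈ Finset.HasAntidiagonal.antidiagonal T.size,
      ∑ T₁ ∈ RTree.ofSize p.1, ∑ T₂ ∈ RTree.ofSize p.2,
        ((RTree.grafts T₁ T₂).count T : R) * (A T₁ * B T₂) =
      ∑ T₁ ∈ RTree.upTo n, ∑ T₂ ∈ RTree.upTo n, if p = (T₁.size, T₂.size) then
        ((RTree.grafts T₁ T₂).count T : R) * (A T₁ * B T₂) else 0 := by
    rintro ⟨a, b⟩ hp
    rw [Finset.HasAntidiagonal.mem_antidiagonal] at hp
    simp only at hp
    have filt : ∀ c ≤ n, RTree.ofSize c = (RTree.upTo n).filter fun S => c = S.size := by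
      intro c hc
      ext S
      rw [RTree.mem_ofSize, Finset.mem_filter, RTree.mem_upTo]
      omega
    rw [filt a (by omega), filt b (by omega), Finset.sum_filter]
    refine Finset.sum_congr rfl fun T₁ _ => ?_
    rw [Finset.sum_filter]
    by_cases ha : a = T₁.size <;> simp [ha]
  rw [preLie, Finset.sum_congr rfl h1, Finset.sum_comm]
  refine Finset.sum_congr rfl fun T₁ _ => ?_
  rw [Finset.sum_comm]
  refine Finset.sum_congr rfl fun T₂ _ => ?_
  rw [Finset.sum_ite_eq']
  split_ifs with h'
  · rfl
  · rw [Finset.HasAntidiagonal.mem_antidiagonal] at h'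
    rw [RTree.count_grafts_eq_zero (Ne.symm h'), Nat.cast_zero, zero_mul]

/-- Both grafted trees have at least one vertex, hence each is strictly smaller than T. All
recursions on the number of vertices rest on this. -/
theorem preLie_congr {A A' B B' : PLHat R} {T : RTree}
    (hA : ∀ S, S.size < T.size → A S = A' S) (hB : ∀ S, S.size < T.size → B S = B' S) :
    preLie A B T = preLie A' B' T := by
  rw [preLie_eq_sum A B T le_rfl, preLie_eq_sum A' B' T le_rfl]
  refine Finset.sum_congr rfl fun T₁ _ => Finset.sum_congr rfl fun T₂ _ => ?_
  by_cases h : T.size = T₁.size + T₂.size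
  · have := T₁.size_pos
    have := T₂.size_pos
    rw [hA T₁ (by omega), hB T₂ (by omega)]
  · rw [RTree.count_grafts_eq_zero h, Nat.cast_zero, zero_mul, zero_mul]

theorem map_preLie {R' : Type*} [CommRing R'] (φ : R →+* R') (A B : PLHat R) :
    φ ∘ preLie A B = preLie (φ ∘ A) (φ ∘ B) := by
  funext T
  simp only [preLie, Function.comp_apply, map_sum, map_mul, map_natCast]

theorem preLie_add_left (A A' B : PLHat R) :
    preLie (A + A') B = preLie A B + preLie A' B := by
  funext T
  simp only [preLie, Pi.add_apply, ← Finset.sum_add_distrib]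
  simp only [add_mul, mul_add]

theorem preLie_smul_left (c : R) (A B : PLHat R) : preLie (c • A) B = c • preLie A B := by
  funext T
  simp only [preLie, Pi.smul_apply, smul_eq_mul, Finset.mul_sum]
  refine Finset.sum_congr rfl fun p _ => Finset.sum_congr rfl fun T₁ _ =>
    Finset.sum_congr rfl fun T₂ _ => ?_
  ring

theorem preLie_zero_left (B : PLHat R) : preLie 0 B = 0 := by
  simpa using preLie_smul_left 0 (0 : PLHat R) B

theorem preLie_bullet_node (A : PLHat R) (m : Multiset RTree) :
    preLie (bullet R) A (RTree.node m) = ∑ T ∈ m.toFinset, if m = {T} then A T else 0 := by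
  have hs : RTree.single ∈ RTree.upTo (RTree.node m).size := by
    rw [RTree.mem_upTo, RTree.single_eq_node, RTree.size_node, RTree.size_node]
    simp
  rw [preLie_eq_sum _ _ _ le_rfl, Finset.sum_eq_single_of_mem _ hs]
  · have hg : ∀ t, RTree.grafts RTree.single t = {RTree.node {t}} := by
      intro t
      rw [RTree.single_eq_node, RTree.grafts_node]
      simp [RTree.graftsForest]
    have : m.toFinset ⊆ RTree.upTo (RTree.node m).size := by
      intro T hT
      rw [RTree.mem_upTo]
      exact (RTree.size_lt_of_mem (Multiset.mem_toFinset.1 hT)).le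
    rw [Finset.sum_subset this]
    · refine Finset.sum_congr rfl fun T _ => ?_
      rw [hg, Multiset.count_singleton, RTree.node_injective.eq_iff]
      by_cases h : m = {T} <;> simp [h, bullet]
    · intro T _ hT
      rw [if_neg]
      rintro rfl
      simp at hT
  · intro T _ hT
    simp [bullet, hT]

end PreLie

/-- A tree of B is grafted either on the new root, which multiplies the forest by B, or on a vertex
of one tree of the forest, which acts by the Leibniz rule. In other words B₊(exp z) ↶ B = B₊((B + z
↶ B) · exp z). -/
theorem preLie_nodeExp_node {R : Type*} [CommRing R] [Algebra ℚ R] (z B : PLHat R)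
    (m : Multiset RTree) :
    preLie (nodeExp z) B (RTree.node m) =
      ∑ T ∈ m.toFinset, (B T + preLie z B T) * expForest z (m.erase T) := by
  set n := (RTree.node m).size with hn
  set F := RTree.upTo n with hF
  have hmem : ∀ T ∈ m, T.size < n := fun T hT => RTree.size_lt_of_mem hT
  have sz : ∀ T ∈ m, ∀ S : RTree, (RTree.node (S ::ₘ m.erase T)).size + T.size = n + S.size := by
    intro T hT S
    rw [hn, RTree.size_node, RTree.size_node, Multiset.map_cons, Multiset.sum_cons]
    conv_rhs => rw [← Multiset.cons_erase hT, Multiset.map_cons, Multiset.sum_cons]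
    omega
  have cond : ∀ T ∈ m, ∀ T₁ T₂ : RTree,
      (m = T₂ ::ₘ T₁.children ∧ T = T₂) ↔ (T₁ = RTree.node (m.erase T) ∧ T = T₂) := by
    intro T hT T₁ T₂
    refine and_congr_left fun h => ?_
    subst h
    constructor
    · intro h
      rw [h, Multiset.erase_cons_head, RTree.node_children]
    · rintro rfl
      rw [RTree.children_node, Multiset.cons_erase hT]
  -- Graftings on the root: T₂ becomes one of the trees of m, and T₁ is recovered by erasing it.
  have part1 : ∑ T₁ ∈ F, ∑ T₂ ∈ F, ((if m = T₂ ::ₘ T₁.children then 1 else 0 : ℕ) : R) *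
      (nodeExp z T₁ * B T₂) = ∑ T ∈ m.toFinset, B T * expForest z (m.erase T) := by
    have : ∀ T₁ ∈ F, ∀ T₂ ∈ F, ((if m = T₂ ::ₘ T₁.children then 1 else 0 : ℕ) : R) *
        (nodeExp z T₁ * B T₂) = ∑ T ∈ m.toFinset, if T₁ = RTree.node (m.erase T) ∧ T = T₂ then
          B T * expForest z (m.erase T) else 0 := by
      intro T₁ _ T₂ _
      by_cases h : m = T₂ ::ₘ T₁.children
      · have h2 : T₂ ∈ m.toFinset := by rw [h]; simp
        rw [if_pos h, Finset.sum_eq_single_of_mem T₂ h2]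
        · have h3 := (cond T₂ (Multiset.mem_toFinset.1 h2) T₁ T₂).1 ⟨h, rfl⟩
          rw [if_pos h3, h3.1, nodeExp_node, Nat.cast_one, one_mul, mul_comm]
        · intro T _ hT
          exact if_neg fun h => hT h.2
      · rw [if_neg h, Nat.cast_zero, zero_mul]
        refine (Finset.sum_eq_zero fun T hT => if_neg fun h' => h ?_).symm
        exact ((cond T (Multiset.mem_toFinset.1 hT) T₁ T₂).2 h').1
    rw [Finset.sum_congr rfl fun T₁ h₁ => Finset.sum_congr rfl (this T₁ h₁)]
    rw [Finset.sum_congr rfl fun T₁ _ => Finset.sum_comm, Finset.sum_comm]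
    refine Finset.sum_congr rfl fun T hT => ?_
    rw [Multiset.mem_toFinset] at hT
    have hTF : T ∈ F := RTree.mem_upTo.2 (hmem T hT).le
    have hNF : RTree.node (m.erase T) ∈ F := by
      have h1 := sz T hT T
      have h2 := RTree.size_node (T ::ₘ m.erase T)
      have h3 := RTree.size_node (m.erase T)
      rw [Multiset.map_cons, Multiset.sum_cons] at h2
      rw [hF, RTree.mem_upTo]
      omega
    rw [Finset.sum_eq_single_of_mem _ hNF, Finset.sum_eq_single_of_mem _ hTF]
    · simp
    · intro T₂ _ h
      exact if_neg fun h' => h h'.2.symm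
    · intro T₁ _ h
      exact Finset.sum_eq_zero fun T₂ _ => if_neg fun h' => h h'.1
  -- Graftings above the root: a tree S of T₁ is replaced by a tree T of m. The multiplicity of S in
  -- T₁ is absorbed by `expForest_cons`.
  have part2 : ∑ T₁ ∈ F, ∑ T₂ ∈ F, ((RTree.graftsForest T₁.children T₂).count m : R) *
      (nodeExp z T₁ * B T₂) = ∑ T ∈ m.toFinset, preLie z B T * expForest z (m.erase T) := by
    have step : ∀ T₁ ∈ F, ∀ T₂ ∈ F, ((RTree.graftsForest T₁.children T₂).count m : R) *
        (nodeExp z T₁ * B T₂) = ∑ T ∈ m.toFinset, ∑ S ∈ F,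
          if T₁ = RTree.node (S ::ₘ m.erase T) then
            ((RTree.grafts S T₂).count T : R) * (z S * B T₂) * expForest z (m.erase T) else 0 := by
      intro T₁ h₁ T₂ _
      have hsub : T₁.children.toFinset ⊆ F := by
        intro S hS
        rw [Multiset.mem_toFinset] at hS
        rw [hF, RTree.mem_upTo] at h₁ ⊢
        exact (RTree.size_lt_of_mem_children hS).le.trans h₁
      rw [RTree.count_graftsForest, Nat.cast_sum, Finset.sum_mul]
      refine Finset.sum_congr rfl fun T _ => ?_
      rw [Nat.cast_sum, Finset.sum_mul]
      refine Eq.trans ?_ (Finset.sum_subset hsub ?_)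
      · refine Finset.sum_congr rfl fun S hS => ?_
        rw [Multiset.mem_toFinset] at hS
        by_cases h : T₁.children.erase S = m.erase T
        · have h' : T₁.children = S ::ₘ m.erase T := by rw [← h, Multiset.cons_erase hS]
          have h2 : T₁ = RTree.node (S ::ₘ m.erase T) := by rw [← h', RTree.node_children]
          have h3 := expForest_cons z S (m.erase T)
          rw [if_pos h, if_pos h2, h', nodeExp, h', Multiset.count_cons_self]
          push_cast
          linear_combination ((RTree.grafts S T₂).count T : R) * B T₂ * h3
        · rw [if_neg h, if_neg, Nat.cast_zero, zero_mul]
          rintro rfl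
          rw [RTree.children_node, Multiset.erase_cons_head] at h
          exact h rfl
      · intro S _ hS
        refine if_neg ?_
        rintro rfl
        rw [RTree.children_node] at hS
        simp at hS
    rw [Finset.sum_congr rfl fun T₁ h₁ => Finset.sum_congr rfl (step T₁ h₁)]
    rw [Finset.sum_congr rfl fun T₁ _ => Finset.sum_comm, Finset.sum_comm]
    refine Finset.sum_congr rfl fun T hT => ?_
    rw [Multiset.mem_toFinset] at hT
    rw [preLie_eq_sum z B T (hmem T hT).le, Finset.sum_mul,
      Finset.sum_congr rfl fun T₁ _ => Finset.sum_comm, Finset.sum_comm]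
    refine Finset.sum_congr rfl fun S _ => ?_
    rw [Finset.sum_mul, Finset.sum_comm]
    refine Finset.sum_congr rfl fun T₂ _ => ?_
    rw [Finset.sum_ite_eq']
    split_ifs with h
    · rfl
    · rw [RTree.count_grafts_eq_zero, Nat.cast_zero, zero_mul, zero_mul]
      intro h'
      apply h
      rw [hF, RTree.mem_upTo]
      have := sz T hT S
      omega
  rw [preLie_eq_sum _ _ _ le_rfl]
  simp only [add_mul, Finset.sum_add_distrib]
  rw [← part1, ← part2, ← Finset.sum_add_distrib]
  refine Finset.sum_congr rfl fun T₁ _ => ?_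
  rw [← Finset.sum_add_distrib]
  refine Finset.sum_congr rfl fun T₂ _ => ?_
  rw [RTree.count_node_grafts, Nat.cast_add, add_mul]

-- The right action of power series in a fixed element.

section Act

variable {R : Type*} [CommRing R]

theorem preLie_sum_smul_left {ι : Type*} (s : Finset ι) (c : ι → R) (A : ι → PLHat R)
    (B : PLHat R) :
    preLie (∑ i ∈ s, c i • A i) B = ∑ i ∈ s, c i • preLie (A i) B := by
  induction s using Finset.induction_on with
  | empty => simp [preLie_zero_left]
  | insert a s h ih => rw [Finset.sum_insert h, Finset.sum_insert h, preLie_add_left, ih,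
      preLie_smul_left]

theorem actPow_add_left (A A' B : PLHat R) (k : ℕ) :
    actPow (A + A') B k = actPow A B k + actPow A' B k := by
  induction k with
  | zero => rfl
  | succ k ih => rw [actPow, ih, preLie_add_left]; rfl

theorem actPow_smul_left (c : R) (A B : PLHat R) (k : ℕ) :
    actPow (c • A) B k = c • actPow A B k := by
  induction k with
  | zero => rfl
  | succ k ih => rw [actPow, ih, preLie_smul_left]; rfl

theorem actPow_zero_left (B : PLHat R) (k : ℕ) : actPow 0 B k = 0 := by
  simpa using actPow_smul_left 0 (0 : PLHat R) B k

theorem map_actPow {R' : Type*} [CommRing R'] (φ : R →+* R') (A B : PLHat R) (k : ℕ) :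
    φ ∘ actPow A B k = actPow (φ ∘ A) (φ ∘ B) k := by
  induction k with
  | zero => rfl
  | succ k ih => rw [actPow, map_preLie, ih]; rfl

theorem actPow_congr {A A' B B' : PLHat R} {T : RTree} {k : ℕ}
    (hA : ∀ S, S.size + k ≤ T.size → A S = A' S) (hB : ∀ S, S.size < T.size → B S = B' S) :
    actPow A B k T = actPow A' B' k T := by
  induction k generalizing T with
  | zero => exact hA T le_rfl
  | succ k ih =>
    exact preLie_congr (fun S hS => ih (fun U hU => hA U (by omega)) fun U hU => hB U (by omega)) hB

theorem map_shift {R' : Type*} [CommRing R'] (φ : R →+* R') (q : R) (A : PLHat R) :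
    φ ∘ shift q A = shift (φ q) (φ ∘ A) := by
  funext T
  simp [shift]

theorem map_bullet {R' : Type*} [CommRing R'] (φ : R →+* R') :
    φ ∘ bullet R = bullet R' := by
  funext T
  simp only [bullet, Function.comp_apply, Pi.single_apply]
  split_ifs <;> simp

theorem shift_add (q : R) (A B : PLHat R) : shift q (A + B) = shift q A + shift q B := by
  funext T
  simp [shift, mul_add]

theorem shift_smul (q c : R) (A : PLHat R) : shift q (c • A) = c • shift q A := by
  funext T
  simp [shift, mul_left_comm]

variable [Algebra ℚ R]

theorem act_apply_of_le (A : PLHat R) (f : PowerSeries ℚ) (B : PLHat R) {T : RTree} {n : ℕ}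
    (h : T.size ≤ n) :
    act A f B T = ∑ k ∈ Finset.range n, algebraMap ℚ R (PowerSeries.coeff k f) *
      actPow A B k T := by
  refine Finset.sum_subset (Finset.range_mono h) fun k _ hk => ?_
  rw [actPow_eq_zero A B k T (by simpa using hk), mul_zero]

theorem act_congr {A A' B B' : PLHat R} (f : PowerSeries ℚ) {T : RTree}
    (hA : ∀ S, S.size ≤ T.size → A S = A' S) (hB : ∀ S, S.size < T.size → B S = B' S) :
    act A f B T = act A' f B' T :=
  Finset.sum_congr rfl fun k _ => by rw [actPow_congr (fun S hS => hA S (by omega)) hB]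

theorem act_add_left (A A' : PLHat R) (f : PowerSeries ℚ) (B : PLHat R) :
    act (A + A') f B = act A f B + act A' f B := by
  funext T
  simp only [act, actPow_add_left, Pi.add_apply, mul_add, Finset.sum_add_distrib]

theorem act_smul_left (c : R) (A : PLHat R) (f : PowerSeries ℚ) (B : PLHat R) :
    act (c • A) f B = c • act A f B := by
  funext T
  simp only [act, actPow_smul_left, Pi.smul_apply, smul_eq_mul, Finset.mul_sum, mul_left_comm]

theorem act_zero_left (f : PowerSeries ℚ) (B : PLHat R) : act 0 f B = 0 := by
  simpa using act_smul_left 0 (0 : PLHat R) f B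

theorem map_act {R' : Type*} [CommRing R'] [Algebra ℚ R'] (φ : R →+* R') (A : PLHat R)
    (f : PowerSeries ℚ) (B : PLHat R) : φ ∘ act A f B = act (φ ∘ A) f (φ ∘ B) := by
  funext T
  simp only [act, Function.comp_apply, map_sum, map_mul, ← map_actPow,
    RingHom.map_rat_algebraMap]

theorem act_one (A B : PLHat R) : act A 1 B = A := by
  funext T
  rw [act, Finset.sum_eq_single_of_mem 0 (Finset.mem_range.2 T.size_pos)]
  · simp [actPow]
  · intro k _ hk
    simp [PowerSeries.coeff_one, hk]

theorem act_sub_one (A : PLHat R) (f : PowerSeries ℚ) (B : PLHat R) :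
    act A (f - 1) B = act A f B - A := by
  have : act A (f - 1) B = act A f B - act A 1 B := by
    funext T
    simp only [act, map_sub, sub_mul, Finset.sum_sub_distrib, Pi.sub_apply]
  rw [this, act_one]

theorem actPow_act (A : PLHat R) (f : PowerSeries ℚ) (B : PLHat R) (k : ℕ) (T : RTree) {n : ℕ}
    (h : T.size ≤ n) :
    actPow (act A f B) B k T = ∑ j ∈ Finset.range n,
      algebraMap ℚ R (PowerSeries.coeff j f) * actPow A B (j + k) T := by
  induction k generalizing T with
  | zero => exact act_apply_of_le A f B h
  | succ k ih =>
    have : preLie (actPow (act A f B) B k) B T = preLie (∑ j ∈ Finset.range n,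
        algebraMap ℚ R (PowerSeries.coeff j f) • actPow A B (j + k)) B T := by
      refine preLie_congr (fun S hS => ?_) fun _ _ => rfl
      rw [ih S (by omega)]
      simp only [Finset.sum_apply, Pi.smul_apply, smul_eq_mul]
    rw [actPow, this, preLie_sum_smul_left]
    simp only [Finset.sum_apply, Pi.smul_apply, smul_eq_mul]
    rfl

/-- Powers of the same B compose by adding exponents, so the action is multiplicative in the power
series. This makes the equation of Ω invertible. -/
theorem act_act (A : PLHat R) (f g : PowerSeries ℚ) (B : PLHat R) :
    act (act A f B) g B = act A (f * g) B := by
  funext T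
  set n := T.size with hn
  have h1 : ∀ i ∈ Finset.range n, algebraMap ℚ R (PowerSeries.coeff i (f * g)) * actPow A B i T =
      ∑ j ∈ Finset.range n, ∑ k ∈ Finset.range n, if i = j + k then
        algebraMap ℚ R (PowerSeries.coeff k g) *
          (algebraMap ℚ R (PowerSeries.coeff j f) * actPow A B (j + k) T) else 0 := by
    intro i hi
    rw [Finset.mem_range] at hi
    have : Finset.HasAntidiagonal.antidiagonal i =
        (Finset.range n ×ˢ Finset.range n).filter fun p => i = p.1 + p.2 := by
      ext p
      simp only [Finset.HasAntidiagonal.mem_antidiagonal, Finset.mem_filter, Finset.mem_product, Finset.mem_range]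
      omega
    rw [PowerSeries.coeff_mul, map_sum, Finset.sum_mul, this, Finset.sum_filter,
      Finset.sum_product]
    refine Finset.sum_congr rfl fun j _ => Finset.sum_congr rfl fun k _ => ?_
    split_ifs with h
    · rw [h, map_mul]
      ring
    · rfl
  rw [act, act, ← hn, Finset.sum_congr rfl h1, Finset.sum_comm]
  simp_rw [Finset.sum_comm (s := Finset.range n) (t := Finset.range n)
    (f := fun i k => if i = _ + k then _ else _)]
  simp only [Finset.sum_ite_eq']
  rw [Finset.sum_comm]
  refine Finset.sum_congr rfl fun k _ => ?_
  rw [actPow_act A f B k T le_rfl, Finset.mul_sum]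
  refine Finset.sum_congr rfl fun j _ => ?_
  split_ifs with h
  · rfl
  -- The pairs with j + k ≥ n are missing from one side only; they contribute nothing.
  · rw [actPow_eq_zero A B (j + k) T (by simpa [hn] using h), mul_zero, mul_zero]

end Act

-- Linear and affine flows with polynomial time dependence.

section Flow

open Polynomial

variable {R : Type*} [CommRing R]

theorem coeff_preLie_C (w : PLHat R[X]) (B : PLHat R) (T : RTree) (k : ℕ) :
    (preLie w (C ∘ B) T).coeff k = preLie (fun S => (w S).coeff k) B T := by
  simp only [preLie, finsetSum_coeff, Function.comp_apply, coeff_natCast_mul, coeff_mul_C]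

theorem coeff_actPow_C (w : PLHat R[X]) (B : PLHat R) (j : ℕ) (T : RTree) (k : ℕ) :
    (actPow w (C ∘ B) j T).coeff k = actPow (fun S => (w S).coeff k) B j T := by
  induction j generalizing T with
  | zero => rfl
  | succ j ih =>
    rw [actPow, coeff_preLie_C, actPow]
    exact preLie_congr (fun S _ => ih S) fun _ _ => rfl

variable [Algebra ℚ R]

theorem coeff_act_C (w : PLHat R[X]) (f : PowerSeries ℚ) (B : PLHat R) (T : RTree) (k : ℕ) :
    (act w f (C ∘ B) T).coeff k = act (fun S => (w S).coeff k) f B T := by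
  simp only [act, finsetSum_coeff, ← coeff_actPow_C, ← Algebra.smul_def, coeff_smul]

/-- The Taylor expansion of the linear flow w' = w ↶ B: the coefficients are forced one after the
other, because k + 1 is invertible. -/
theorem coeff_of_derivative_eq {w : PLHat R[X]} {B : PLHat R}
    (h : ∀ T, derivative (w T) = preLie w (C ∘ B) T) (T : RTree) (k : ℕ) :
    (w T).coeff k = (k.factorial : ℚ)⁻¹ • actPow (fun S => (w S).coeff 0) B k T := by
  induction k generalizing T with
  | zero => simp [actPow]
  | succ k ih =>
    have h1 := congrArg (fun p => p.coeff k) (h T)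
    simp only [coeff_derivative, coeff_preLie_C] at h1
    have h2 : (fun S => (w S).coeff k) = (algebraMap ℚ R (k.factorial : ℚ)⁻¹) •
        actPow (fun S => (w S).coeff 0) B k := by
      funext S
      rw [ih, Pi.smul_apply, smul_eq_mul, Algebra.smul_def]
    rw [h2, preLie_smul_left, Pi.smul_apply, smul_eq_mul, ← Algebra.smul_def,
      ← inv_factorial_succ_smul, mul_comm ((k : R) + 1)] at h1
    have hu : IsUnit ((k : R) + 1) := by
      have : IsUnit (algebraMap ℚ R (k + 1)) :=
        (IsUnit.mk0 ((k : ℚ) + 1) (by positivity)).map _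
      simpa using this
    exact hu.mul_right_cancel h1

theorem eval_one_of_derivative_eq {w : PLHat R[X]} {B : PLHat R}
    (h : ∀ T, derivative (w T) = preLie w (C ∘ B) T) (T : RTree) :
    (w T).eval 1 = act (fun S => (w S).coeff 0) (PowerSeries.exp ℚ) B T := by
  -- Each grafting adds a vertex, so the Taylor expansion stops before the order given by the size
  -- of T.
  have hdeg : (w T).natDegree < T.size := by
    refine (Nat.lt_iff_le_pred T.size_pos).2 (natDegree_le_iff_coeff_eq_zero.2 fun k hk => ?_)
    rw [coeff_of_derivative_eq h, actPow_eq_zero _ _ _ _ (by omega), smul_zero]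
  rw [eval_eq_sum_range' hdeg, act]
  refine Finset.sum_congr rfl fun k _ => ?_
  rw [coeff_of_derivative_eq h, PowerSeries.coeff_exp, one_pow, mul_one, Algebra.smul_def]
  simp

/-- The inhomogeneous term B of the affine flow is exactly the contribution of the graftings on the
new root, so B₊(exp z) follows the linear flow. -/
theorem derivative_nodeExp {z : PLHat R[X]} {B : PLHat R}
    (h : ∀ T, derivative (z T) = preLie z (C ∘ B) T + C (B T)) (T : RTree) :
    derivative (nodeExp z T) = preLie (nodeExp z) (C ∘ B) T := by
  rw [← T.node_children, preLie_nodeExp_node, nodeExp_node, derivative_expForest]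
  refine Finset.sum_congr rfl fun S _ => ?_
  rw [h, add_comm, Function.comp_apply]

/-- The solution `z` of `z' = z ↶ B + B` with initial value `A`. -/
noncomputable def affineFlow (A B : PLHat R) : PLHat R[X] := fun T =>
  C (A T) + ∑ k ∈ Finset.range T.size, monomial (k + 1)
    (((k + 1).factorial : ℚ)⁻¹ • (actPow A B (k + 1) T + actPow B B k T))

theorem coeff_affineFlow_zero (A B : PLHat R) (T : RTree) :
    (affineFlow A B T).coeff 0 = A T := by
  simp [affineFlow, coeff_monomial]

theorem coeff_affineFlow_succ (A B : PLHat R) (T : RTree) (k : ℕ) :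
    (affineFlow A B T).coeff (k + 1) =
      ((k + 1).factorial : ℚ)⁻¹ • (actPow A B (k + 1) T + actPow B B k T) := by
  simp only [affineFlow, coeff_add, coeff_C_succ, finsetSum_coeff, coeff_monomial,
    Nat.add_right_cancel_iff, Finset.sum_ite_eq', Finset.mem_range, zero_add]
  split_ifs with h
  · rfl
  · rw [actPow_eq_zero _ _ _ _ (by omega), actPow_eq_zero _ _ _ _ (by omega), add_zero, smul_zero]

theorem derivative_affineFlow (A B : PLHat R) (T : RTree) :
    derivative (affineFlow A B T) = preLie (affineFlow A B) (C ∘ B) T + C (B T) := by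
  ext k
  rw [coeff_derivative, coeff_affineFlow_succ, coeff_add, coeff_preLie_C, mul_comm,
    inv_factorial_succ_smul]
  cases k with
  | zero =>
    simp only [coeff_affineFlow_zero, coeff_C_zero]
    simp [actPow]
  | succ k =>
    have : (fun S => (affineFlow A B S).coeff (k + 1)) =
        (algebraMap ℚ R ((k + 1).factorial : ℚ)⁻¹) • (actPow A B (k + 1) + actPow B B k) := by
      funext S
      rw [coeff_affineFlow_succ, Pi.smul_apply, smul_eq_mul, Algebra.smul_def]
      rfl
    rw [this, preLie_smul_left, preLie_add_left, coeff_C_succ, add_zero, Algebra.smul_def]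
    rfl

/-- The power series `(exp x - 1) / x`. -/
noncomputable def expDiv : PowerSeries ℚ := PowerSeries.mk fun k => ((k + 1).factorial : ℚ)⁻¹

theorem bernoulliPowerSeries_mul_expDiv : bernoulliPowerSeries ℚ * expDiv = 1 := by
  have h : PowerSeries.exp ℚ - 1 = expDiv * PowerSeries.X := by
    ext k
    cases k with
    | zero => simp
    | succ k => simp [expDiv, PowerSeries.coeff_succ_mul_X, PowerSeries.coeff_exp,
        PowerSeries.coeff_one]
  have h1 := bernoulliPowerSeries_mul_exp_sub_one ℚ
  rw [h, ← mul_assoc] at h1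
  exact mul_right_cancel₀ PowerSeries.X_ne_zero (h1.trans (one_mul _).symm)

/-- Acting by (exp Ω - 1)/Ω undoes the action of Ω/(exp Ω - 1). The result says that the affine flow
of Ω started at 0 reaches • at time 1. -/
theorem IsOmega.act_expDiv {Om : PLHat ℚ} (h : IsOmega Om) : act Om expDiv Om = bullet ℚ := by
  have h1 := act_act (bullet ℚ) (bernoulliPowerSeries ℚ) expDiv Om
  rwa [show act (bullet ℚ) (bernoulliPowerSeries ℚ) Om = Om from h,
    bernoulliPowerSeries_mul_expDiv, act_one] at h1

theorem eval_one_affineFlow (A B : PLHat R) (T : RTree) :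
    (affineFlow A B T).eval 1 = act A (PowerSeries.exp ℚ) B T + act B expDiv B T := by
  rw [act_apply_of_le A _ B (Nat.le_succ T.size), Finset.sum_range_succ']
  simp only [affineFlow, act, eval_add, eval_C, eval_finsetSum, eval_monomial, one_pow, mul_one,
    smul_add, Finset.sum_add_distrib, expDiv, PowerSeries.coeff_mk, PowerSeries.coeff_exp,
    ← Algebra.smul_def]
  simp [actPow]
  ring

/-- Let z be the affine flow started at A. Then B₊(exp z) is the linear flow started at B₊(exp A),
so its value at time 1 is the left side, while z(1) = A ↶ exp B + •. -/
theorem act_nodeExp (A : PLHat R) {B : PLHat R} (hB : act B expDiv B = bullet R) :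
    act (nodeExp A) (PowerSeries.exp ℚ) B =
      nodeExp (act A (PowerSeries.exp ℚ) B + bullet R) := by
  funext T
  have h1 := eval_one_of_derivative_eq (derivative_nodeExp (derivative_affineFlow A B)) T
  have h2 : (fun S => (nodeExp (affineFlow A B) S).coeff 0) = nodeExp A := by
    have h3 := map_nodeExp (constantCoeff (R := R)) (affineFlow A B)
    have h4 : constantCoeff ∘ affineFlow A B = A := funext fun S => coeff_affineFlow_zero A B S
    rw [h4] at h3
    exact h3
  have h3 := congrFun (map_nodeExp (evalRingHom (1 : R)) (affineFlow A B)) T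
  have h4 : evalRingHom (1 : R) ∘ affineFlow A B = act A (PowerSeries.exp ℚ) B + bullet R := by
    funext S
    rw [Function.comp_apply, coe_evalRingHom, eval_one_affineFlow, hB]
    rfl
  rw [h2] at h1
  rw [h4] at h3
  exact h1.symm.trans h3

end Flow

-- Recursive equations for tree series, and the existence of Ω.

/-- Recursion on the number of vertices. -/
theorem existsUnique_fixedPoint {R : Type*} [Zero R] (F : PLHat R → PLHat R)
    (hF : ∀ (A B : PLHat R) (T : RTree), (∀ S, S.size < T.size → A S = B S) → F A T = F B T) :
    ∃! A, F A = A := by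
  -- The iterates of F from 0 are stationary at T once their number exceeds the size of T.
  have key : ∀ (n k : ℕ) (T : RTree), T.size < n → T.size < k → F^[n] 0 T = F^[k] 0 T := by
    intro n
    induction n with
    | zero => intro k T h; omega
    | succ n ih =>
      intro k T hn hk
      obtain ⟨k, rfl⟩ : ∃ j, k = j + 1 := ⟨k - 1, by omega⟩
      rw [Function.iterate_succ_apply', Function.iterate_succ_apply']
      exact hF _ _ _ fun S hS => ih k S (by omega) (by omega)
  refine ⟨fun T => F^[T.size + 1] 0 T, ?_, ?_⟩
  · funext T
    rw [Function.iterate_succ_apply']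
    exact hF _ _ _ fun S hS => key _ _ _ (by omega) hS
  · intro B hB
    have : ∀ (n : ℕ) (T : RTree), T.size < n → B T = F^[n] 0 T := by
      intro n
      induction n with
      | zero => intro T h; omega
      | succ n ih =>
        intro T hn
        rw [Function.iterate_succ_apply', ← congrFun hB T]
        exact hF _ _ _ fun S hS => ih S (by omega)
    funext T
    exact this _ T (Nat.lt_succ_self _)

theorem existsUnique_isOmega : ∃! Om : PLHat ℚ, IsOmega Om := by
  refine existsUnique_fixedPoint (fun Om => act (bullet ℚ) (bernoulliPowerSeries ℚ) Om) ?_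
  exact fun A B T h => act_congr _ (fun _ _ => rfl) h

-- The Euler scheme with geometric time steps.

section Step

open Polynomial

variable {K : Type*} [CommRing K]

/-- The substitution `Y ↦ q Y + 1`. -/
noncomputable def qStep (q : K) : K[X] →+* K[X] := compRingHom (C q * X + 1)

theorem qStep_X (q : K) : qStep q X = C q * X + 1 := by simp [qStep]

theorem qStep_C (q c : K) : qStep q (C c) = C c := by simp [qStep]

theorem qStep_comp_C (q : K) (B : PLHat K) : qStep q ∘ (C ∘ B) = C ∘ B :=
  funext fun _ => qStep_C q _

theorem eval_qStep (q x : K) (p : K[X]) : (qStep q p).eval x = p.eval (q * x + 1) := by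
  simp [qStep]

/-- The map Y ↦ qY + 1 sends each q-integer 1 + q + … + qⁿ⁻¹ to the next one, starting from 0. All
of them are therefore roots of p, and they are pairwise distinct. -/
theorem eq_zero_of_qStep_eq [IsDomain K] {q : K} (hq : q ≠ 0)
    (h : ∀ n, ∑ i ∈ Finset.range (n + 1), q ^ i ≠ 0) {p : K[X]} (hp : qStep q p = p)
    (hp0 : p.coeff 0 = 0) : p = 0 := by
  have hroot : ∀ n, p.eval (∑ i ∈ Finset.range n, q ^ i) = 0 := by
    intro n
    induction n with
    | zero => rw [Finset.sum_range_zero, ← coeff_zero_eq_eval_zero, hp0]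
    | succ n ih => rw [geom_sum_succ, ← eval_qStep, hp, ih]
  have hinj : Function.Injective fun n => ∑ i ∈ Finset.range n, q ^ i := by
    refine Function.Injective.of_lt_imp_ne fun m n hmn he => ?_
    obtain ⟨d, rfl⟩ : ∃ d, n = m + (d + 1) := ⟨n - m - 1, by omega⟩
    simp only [Finset.sum_range_add _ m, pow_add q m, ← Finset.mul_sum] at he
    exact mul_ne_zero (pow_ne_zero m hq) (h d) (left_eq_add.1 he)
  refine eq_zero_of_infinite_isRoot p ((Set.infinite_range_of_injective hinj).mono ?_)
  rintro _ ⟨n, rfl⟩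
  exact hroot n

/-- The difference (qY + 1)ⁿ⁺¹ - Yⁿ⁺¹ is 1 + (q - 1)Y times a polynomial of degree at most n, whose
coefficient of Yⁿ is the q-integer 1 + q + … + qⁿ. Inverting it removes the top term of g, and
induction on the degree finishes. -/
theorem exists_qStep_sub_eq {q : K} (h : ∀ n, IsUnit (∑ i ∈ Finset.range (n + 1), q ^ i))
    (g : K[X]) :
    ∃ p : K[X], p.coeff 0 = 0 ∧ qStep q p = p + (1 + C (q - 1) * X) * g := by
  have key : ∀ (n : ℕ) (g : K[X]), g.degree < n →
      ∃ p : K[X], p.coeff 0 = 0 ∧ qStep q p = p + (1 + C (q - 1) * X) * g := by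
    intro n
    induction n with
    | zero =>
      intro g hg
      have : g = 0 := by simpa using hg
      exact ⟨0, by simp [this]⟩
    | succ n ih =>
      intro g hg
      set s := ∑ i ∈ Finset.range (n + 1), (C q * X + 1) ^ i * (X : K[X]) ^ (n + 1 - 1 - i) with hs
      have hdeg : ∀ i ≤ n, ((C q * X + 1) ^ i * (X : K[X]) ^ (n - i)).natDegree ≤ n := by
        intro i hi
        have h1 : (C q * X + 1 : K[X]).natDegree ≤ 1 := by compute_degree
        have h2 := natDegree_pow_le_of_le i h1
        have h3 := natDegree_mul_le_of_le h2 (natDegree_X_pow_le (R := K) (n - i))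
        omega
      have hcoeff : ∀ i ≤ n, ((C q * X + 1) ^ i * (X : K[X]) ^ (n - i)).coeff n = q ^ i := by
        intro i hi
        have h1 : (C q * X + 1 : K[X]).natDegree ≤ 1 := by compute_degree
        rw [coeff_mul_X_pow', if_pos (by omega), show n - (n - i) = i * 1 by omega,
          coeff_pow_of_natDegree_le h1]
        simp [coeff_one]
      have hs1 : s.natDegree ≤ n := by
        refine natDegree_sum_le_of_forall_le _ _ fun i hi => ?_
        rw [Finset.mem_range] at hi
        exact hdeg i (by omega)
      have hs2 : s.coeff n = ∑ i ∈ Finset.range (n + 1), q ^ i := by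
        rw [hs, finsetSum_coeff]
        refine Finset.sum_congr rfl fun i hi => ?_
        rw [Finset.mem_range] at hi
        exact hcoeff i (by omega)
      have hs3 : s * (1 + C (q - 1) * X) = (C q * X + 1) ^ (n + 1) - X ^ (n + 1) := by
        rw [← (Commute.all (C q * X + 1 : K[X]) X).geom_sum₂_mul, hs]
        congr 1
        rw [C_sub, C_1]
        ring
      obtain ⟨u, hu⟩ := h n
      set c : K := g.coeff n * ↑u⁻¹ with hc
      have hg' : (g - C c * s).degree < n := by
        rw [degree_lt_iff_coeff_zero]
        intro m hm
        rcases hm.eq_or_lt with rfl | hm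
        · rw [coeff_sub, coeff_C_mul, hs2, ← hu, hc]
          simp
        · rw [coeff_sub, coeff_C_mul, coeff_eq_zero_of_natDegree_lt (hs1.trans_lt hm),
            coeff_eq_zero_of_degree_lt (hg.trans_le (by exact_mod_cast hm))]
          simp
      obtain ⟨p, hp0, hp⟩ := ih _ hg'
      refine ⟨p + C c * X ^ (n + 1), by simp [hp0], ?_⟩
      rw [map_add, map_mul, map_pow, qStep_C, qStep_X, hp]
      linear_combination (-C c) * hs3
  exact key (g.natDegree + 1) g (degree_le_natDegree.trans_lt (by exact_mod_cast Nat.lt_succ_self _))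

variable [Algebra ℚ K]

/-- The equation `P(q Y + 1) - P(Y) = (1 + (q - 1) Y) B₊(exp P(Y))`, `P(0) = 0`, for a series of
rooted trees `P` with polynomial coefficients: the iterates of the Euler scheme with time steps
`1, q, q², …` in terms of the `q`-analogue `Y` of the number of iterations. -/
structure IsEulerOrbit (q : K) (P : PLHat K[X]) : Prop where
  coeff_zero : ∀ T, (P T).coeff 0 = 0
  step : ∀ T, qStep q (P T) = P T + (1 + C (q - 1) * X) * nodeExp P T

theorem exists_isEulerOrbit {q : K} (h : ∀ n, IsUnit (∑ i ∈ Finset.range (n + 1), q ^ i)) :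
    ∃ P, IsEulerOrbit q P := by
  choose G hG0 hG using exists_qStep_sub_eq h
  -- The right side of the difference equation at T involves P only on the subtrees at the root of
  -- T, so the equation is solved one tree at a time.
  obtain ⟨P, hP, -⟩ := existsUnique_fixedPoint (fun (P : PLHat K[X]) T => G (nodeExp P T))
    (by
      intro A B T hAB
      exact congrArg G (expForest_congr fun S hS => hAB S (RTree.size_lt_of_mem_children hS)))
  refine ⟨P, fun T => ?_, fun T => ?_⟩ <;> rw [← congrFun hP T]
  · exact hG0 _
  · rw [hG]

theorem eq_of_qStep_eq [IsDomain K] {q : K} (hq : q ≠ 0)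
    (h : ∀ n, ∑ i ∈ Finset.range (n + 1), q ^ i ≠ 0) {c : K[X]} {P Q : PLHat K[X]}
    (h0 : ∀ T, (P T).coeff 0 = (Q T).coeff 0)
    (hP : ∀ T, qStep q (P T) = P T + c * nodeExp P T)
    (hQ : ∀ T, qStep q (Q T) = Q T + c * nodeExp Q T) : P = Q := by
  funext T
  induction hn : T.size using Nat.strong_induction_on generalizing T with
  | _ n ih =>
    have : nodeExp P T = nodeExp Q T :=
      expForest_congr fun S hS => ih _ (hn ▸ RTree.size_lt_of_mem_children hS) S rfl
    rw [← sub_eq_zero]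
    refine eq_zero_of_qStep_eq hq h ?_ (by rw [coeff_sub, h0, sub_self])
    rw [map_sub, hP, hQ, this]
    ring

theorem IsEulerOrbit.map {K' : Type*} [CommRing K'] [Algebra ℚ K'] (φ : K →+* K') {q : K}
    {P : PLHat K[X]} (h : IsEulerOrbit q P) : IsEulerOrbit (φ q) (mapRingHom φ ∘ P) where
  coeff_zero T := by simp [h.coeff_zero T]
  step T := by
    have h1 := congrArg (mapRingHom φ) (h.step T)
    have h2 := congrFun (map_nodeExp (mapRingHom φ) P) T
    rw [Function.comp_apply] at h2
    rw [map_add, map_mul, h2] at h1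
    rw [Function.comp_apply]
    refine Eq.trans ?_ (h1.trans ?_)
    · simp [qStep, Polynomial.map_comp]
    · simp

theorem IsEulerOrbit.coeff_zero_comp {q : K} {P : PLHat K[X]} (h : IsEulerOrbit q P) :
    constantCoeff ∘ P = 0 :=
  funext h.coeff_zero

theorem IsEulerOrbit.coeff_zero_nodeExp {q : K} {P : PLHat K[X]} (h : IsEulerOrbit q P)
    (T : RTree) : (nodeExp P T).coeff 0 = bullet K T := by
  have := congrFun (map_nodeExp constantCoeff P) T
  rwa [h.coeff_zero_comp, nodeExp_zero] at this

/-- As P(0) = 0, only forests with a single tree contribute to first order in Y, and B₊ of a single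
tree is the grafting of that tree on •. -/
theorem IsEulerOrbit.coeff_one_nodeExp {q : K} {P : PLHat K[X]} (h : IsEulerOrbit q P)
    (T : RTree) : (nodeExp P T).coeff 1 = preLie (bullet K) (fun S => (P S).coeff 1) T := by
  have h1 : (nodeExp P T).coeff 1 = (derivative (nodeExp P T)).coeff 0 := by
    simp [coeff_derivative]
  rw [h1, ← T.node_children, preLie_bullet_node, nodeExp_node, derivative_expForest,
    finsetSum_coeff]
  refine Finset.sum_congr rfl fun S hS => ?_
  rw [Multiset.mem_toFinset] at hS
  have h2 : (expForest P (T.children.erase S)).coeff 0 =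
      bullet K (RTree.node (T.children.erase S)) := by
    rw [← h.coeff_zero_nodeExp, nodeExp_node]
  have h3 : T.children = {S} ↔ RTree.node (T.children.erase S) = RTree.single := by
    rw [RTree.single_eq_node, RTree.node_injective.eq_iff]
    constructor
    · intro h
      rw [h]
      simp
    · intro h
      rw [← Multiset.cons_erase hS, h]
      rfl
  rw [mul_coeff_zero, h2, bullet, Pi.single_apply, coeff_derivative]
  simp only [h3]
  split_ifs <;> simp

/-- The identity P(qY + 1) = P[q] ↶ exp B + • is proved by uniqueness for the difference equation,
and its coefficient of Y is then read off. -/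
theorem IsEulerOrbit.coeff_one_spec [IsDomain K] {q : K} (hq : q ≠ 0)
    (hn : ∀ n, ∑ i ∈ Finset.range (n + 1), q ^ i ≠ 0) {P : PLHat K[X]} (h : IsEulerOrbit q P)
    {B : PLHat K} (hB : act B expDiv B = bullet K) :
    act (shift q fun T => (P T).coeff 1) (PowerSeries.exp ℚ) B =
      (fun T => (P T).coeff 1) + preLie (bullet K) (fun T => (P T).coeff 1) +
        (q - 1) • bullet K := by
  set σ := qStep q
  set c : K[X] := 1 + C (q - 1) * X with hc
  have hstep : σ ∘ P = P + c • nodeExp P := funext h.step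
  -- Substituting in the orbit equation multiplies the step size by q. The same factor appears for Q
  -- through the root counted by the q-shift.
  have hσc : σ c = C q * c := by
    rw [hc, map_add, map_mul, qStep_C, qStep_X, map_one, C_sub, C_1]
    ring
  have hB' : act (C ∘ B) expDiv (C ∘ B) = bullet K[X] := by
    rw [← map_act (C : K →+* K[X]), hB, map_bullet]
  set Q := act (shift (C q) P) (PowerSeries.exp ℚ) (C ∘ B) + bullet K[X] with hQ
  have hstepQ : ∀ T, σ (Q T) = Q T + (C q * c) * nodeExp Q T := by
    intro T
    have : σ ∘ Q = Q + (C q * c) • nodeExp Q := by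
      have h1 : σ ∘ Q = act (shift (C q) (σ ∘ P)) (PowerSeries.exp ℚ) (C ∘ B) + bullet K[X] := by
        have h2 : σ ∘ Q = σ ∘ act (shift (C q) P) (PowerSeries.exp ℚ) (C ∘ B) +
            σ ∘ bullet K[X] := by
          funext S
          simp [hQ]
        rw [h2, map_act, map_bullet, map_shift, qStep_C, qStep_comp_C]
      rw [h1, hstep, shift_add, shift_smul, shift_nodeExp, act_add_left, act_smul_left,
        act_smul_left, act_nodeExp _ hB', smul_smul, ← hQ, mul_comm c]
      rw [hQ]
      abel
    exact congrFun this T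
  have hstepP : ∀ T, σ ((σ ∘ P) T) = (σ ∘ P) T + (C q * c) * nodeExp (σ ∘ P) T := by
    intro T
    have h1 := congrArg σ (h.step T)
    have h2 := congrFun (map_nodeExp σ P) T
    rw [Function.comp_apply] at h2
    rw [map_add, map_mul, hσc, h2] at h1
    exact h1
  have hinit : ∀ T, ((σ ∘ P) T).coeff 0 = (Q T).coeff 0 := by
    intro T
    have h1 : (fun S => (shift (C q) P S).coeff 0) = (0 : PLHat K) := by
      funext S
      simp [shift, h.coeff_zero S]
    have h2 := congrFun (map_bullet (constantCoeff (R := K))) T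
    rw [Function.comp_apply, constantCoeff_apply] at h2
    rw [hstep, hQ, Pi.add_apply, Pi.add_apply, coeff_add, coeff_add, coeff_act_C, h1, act_zero_left,
      h2, h.coeff_zero, Pi.smul_apply, smul_eq_mul, mul_coeff_zero, h.coeff_zero_nodeExp]
    simp [hc]
  have hPQ := eq_of_qStep_eq hq hn hinit hstepP hstepQ
  funext T
  have h1 : (Q T).coeff 1 = ((σ ∘ P) T).coeff 1 := by rw [hPQ]
  have h2 : (bullet K[X] T).coeff 1 = 0 := by
    rw [bullet, Pi.single_apply]
    split_ifs <;> simp [coeff_one]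
  have h3 : (fun S => (shift (C q) P S).coeff 1) = shift q fun S => (P S).coeff 1 := by
    funext S
    simp only [shift, ← C_pow, coeff_C_mul]
  have h4 : (c * nodeExp P T).coeff 1 = (nodeExp P T).coeff 1 + (q - 1) * bullet K T := by
    rw [hc, add_mul, one_mul, mul_assoc, coeff_add, coeff_C_mul, coeff_X_mul,
      h.coeff_zero_nodeExp]
  rw [hstep, hQ, Pi.add_apply, Pi.add_apply, coeff_add, coeff_add, coeff_act_C, h2, h3, add_zero,
    Pi.smul_apply, smul_eq_mul, h4, h.coeff_one_nodeExp, ← add_assoc] at h1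
  exact h1

/-- The defect w = y(Y + 1) - y(Y) - B₊(exp y(Y)) follows a linear flow, since the inhomogeneous
terms of the first two summands cancel. It starts at y(1) - y(0) - • = 0, so it vanishes. -/
theorem isEulerOrbit_affineFlow {B : PLHat K} (hB : act B expDiv B = bullet K) :
    IsEulerOrbit 1 (affineFlow 0 B) := by
  refine ⟨fun T => coeff_affineFlow_zero 0 B T, fun T => ?_⟩
  set y := affineFlow 0 B with hy
  set w : PLHat K[X] := qStep 1 ∘ y - y - nodeExp y with hw
  have hder : ∀ T, derivative (w T) = preLie w (C ∘ B) T := by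
    intro T
    have h1 : derivative (qStep 1 (y T)) = qStep 1 (derivative (y T)) := by
      simp [qStep, derivative_comp]
    have h2 := congrFun (map_preLie (qStep 1) y (C ∘ B)) T
    rw [qStep_comp_C, Function.comp_apply] at h2
    have h3 : w = qStep 1 ∘ y + (-1 : K[X]) • y + (-1 : K[X]) • nodeExp y := by
      rw [hw]
      module
    rw [h3, preLie_add_left, preLie_add_left, preLie_smul_left, preLie_smul_left]
    simp only [Pi.add_apply, Pi.smul_apply, smul_eq_mul, neg_one_mul, derivative_add,
      derivative_neg, Function.comp_apply, h1]
    rw [derivative_nodeExp (derivative_affineFlow 0 B), hy, derivative_affineFlow, map_add, ← hy,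
      h2, qStep_C]
    ring
  have hinit : (fun S => (w S).coeff 0) = (0 : PLHat K) := by
    funext S
    have h0 : constantCoeff ∘ y = 0 := funext fun S => coeff_affineFlow_zero 0 B S
    have h1 := congrFun (map_nodeExp constantCoeff y) S
    rw [h0, nodeExp_zero, Function.comp_apply, constantCoeff_apply] at h1
    have h2 := congrFun h0 S
    rw [Function.comp_apply, constantCoeff_apply] at h2
    have h3 : (qStep 1 (y S)).coeff 0 = bullet K S := by
      rw [coeff_zero_eq_eval_zero, eval_qStep, mul_zero, zero_add, hy, eval_one_affineFlow, hB,
        act_zero_left, Pi.zero_apply, zero_add]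
    rw [hw, Pi.sub_apply, Pi.sub_apply, coeff_sub, coeff_sub, Function.comp_apply, h1, h2, h3]
    simp
  have hw0 : w T = 0 := by
    ext k
    rw [coeff_of_derivative_eq hder, hinit, actPow_zero_left]
    simp
  rw [sub_self, C_0, zero_mul, add_zero, one_mul, ← sub_eq_zero, ← sub_sub]
  exact hw0

theorem coeff_one_affineFlow (B : PLHat K) (T : RTree) : (affineFlow 0 B T).coeff 1 = B T := by
  rw [show 1 = 0 + 1 from rfl, coeff_affineFlow_succ, actPow_zero_left]
  simp [actPow]

theorem IsEulerOrbit.coeff_one_eq [IsDomain K] {P : PLHat K[X]} (h : IsEulerOrbit 1 P)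
    {B : PLHat K} (hB : act B expDiv B = bullet K) (T : RTree) : (P T).coeff 1 = B T := by
  have : CharZero K := algebraRat.charZero K
  have h' := isEulerOrbit_affineFlow hB
  rw [← coeff_one_affineFlow B T]
  refine congrArg (fun Q : PLHat K[X] => (Q T).coeff 1)
    (eq_of_qStep_eq one_ne_zero (fun n => ?_) (fun T => ?_) h.step h'.step)
  · simpa using Nat.cast_add_one_ne_zero n
  · rw [h.coeff_zero, h'.coeff_zero]

end Step

end PLHat

-- Rational functions without pole at 1, and their evaluation.

section RegularAtOne

/-- The rational functions without pole at `1`. -/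
noncomputable def regularAtOne : Subalgebra ℚ (RatFunc ℚ) where
  carrier := {f | f.denom.eval 1 ≠ 0}
  mul_mem' {f g} hf hg h := by
    have := (Polynomial.IsRoot.def.2 h).dvd (RatFunc.denom_mul_dvd f g)
    rw [Polynomial.IsRoot.def, Polynomial.eval_mul] at this
    exact mul_ne_zero hf hg this
  add_mem' {f g} hf hg h := by
    have := (Polynomial.IsRoot.def.2 h).dvd (RatFunc.denom_add_dvd f g)
    rw [Polynomial.IsRoot.def, Polynomial.eval_mul] at this
    exact mul_ne_zero hf hg this
  algebraMap_mem' r := by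
    have : algebraMap ℚ (RatFunc ℚ) r = RatFunc.C r := by simp
    rw [this, Set.mem_ofPred_eq, RatFunc.denom_C, Polynomial.eval_one]
    exact one_ne_zero

theorem eval₂_denom_ne_zero_of_mem {f : RatFunc ℚ} (h : f ∈ regularAtOne) :
    Polynomial.eval₂ (RingHom.id ℚ) 1 f.denom ≠ 0 := h

theorem div_mem_regularAtOne (p : Polynomial ℚ) {r : Polynomial ℚ} (hr : r.eval 1 ≠ 0) :
    algebraMap _ (RatFunc ℚ) p / algebraMap _ (RatFunc ℚ) r ∈ regularAtOne := by
  intro h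
  exact hr ((Polynomial.IsRoot.def.2 h).dvd (RatFunc.denom_div_dvd p r))

theorem algebraMap_mem_regularAtOne (p : Polynomial ℚ) :
    algebraMap _ (RatFunc ℚ) p ∈ regularAtOne := by
  simpa using div_mem_regularAtOne p (r := 1) (by simp)

/-- The value at `1` of a rational function without pole at `1`. -/
noncomputable def evalOne : regularAtOne →+* ℚ where
  toFun f := f.1.eval (RingHom.id ℚ) 1
  map_one' := RatFunc.eval_one _ _
  map_zero' := RatFunc.eval_zero _ _
  map_mul' f g := RatFunc.eval_mul _ _ (eval₂_denom_ne_zero_of_mem f.2)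
    (eval₂_denom_ne_zero_of_mem g.2)
  map_add' f g := RatFunc.eval_add _ _ (eval₂_denom_ne_zero_of_mem f.2)
    (eval₂_denom_ne_zero_of_mem g.2)

/-- The indeterminate, as a rational function without pole at `1`. -/
noncomputable def regularX : regularAtOne :=
  ⟨RatFunc.X, by simpa using algebraMap_mem_regularAtOne Polynomial.X⟩

theorem evalOne_regularX : evalOne regularX = 1 := RatFunc.eval_X _ _

theorem isUnit_geom_sum_regularX (n : ℕ) :
    IsUnit (∑ i ∈ Finset.range (n + 1), regularX ^ i) := by
  set r : Polynomial ℚ := ∑ i ∈ Finset.range (n + 1), Polynomial.X ^ i with hr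
  have h1 : r.eval 1 ≠ 0 := by
    rw [hr, Polynomial.eval_geom_sum]
    simpa using Nat.cast_add_one_ne_zero (R := ℚ) n
  have h2 : (↑(∑ i ∈ Finset.range (n + 1), regularX ^ i) : RatFunc ℚ) =
      algebraMap _ (RatFunc ℚ) r := by
    simp [hr, regularX]
  have h3 : algebraMap _ (RatFunc ℚ) r ≠ 0 := by
    rw [Ne, FaithfulSMul.algebraMap_eq_zero_iff]
    rintro h
    rw [h] at h1
    simp at h1
  refine IsUnit.of_mul_eq_one ⟨_, div_mem_regularAtOne 1 h1⟩ (Subtype.ext ?_)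
  rw [MulMemClass.coe_mul, h2]
  change _ * (algebraMap _ (RatFunc ℚ) 1 / _) = 1
  rw [map_one, mul_one_div_cancel h3]

end RegularAtOne

-- Existence and uniqueness of Ω_q.

namespace PLHat

theorem act_congr_of_coeff_zero {R : Type*} [CommRing R] [Algebra ℚ R] {A A' : PLHat R}
    {f : PowerSeries ℚ} (hf : PowerSeries.coeff 0 f = 0) (B : PLHat R) {T : RTree}
    (hA : ∀ S, S.size < T.size → A S = A' S) : act A f B T = act A' f B T := by
  refine Finset.sum_congr rfl fun k _ => ?_
  cases k with
  | zero => rw [hf, map_zero, zero_mul, zero_mul]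
  | succ k => rw [actPow_congr (fun S hS => hA S (by omega)) fun _ _ => rfl]

theorem one_sub_X_pow_ne_zero {n : ℕ} (hn : 0 < n) : (1 - RatFunc.X ^ n : RatFunc ℚ) ≠ 0 := by
  have h : (1 - RatFunc.X ^ n : RatFunc ℚ) =
      algebraMap (Polynomial ℚ) (RatFunc ℚ) (1 - Polynomial.X ^ n) := by simp
  rw [h, Ne, FaithfulSMul.algebraMap_eq_zero_iff]
  intro h
  have := congrArg (Polynomial.eval 0) h
  simp [hn.ne'] at this

/-- Since exp Ω - 1 has no constant term, Ω_q at T itself enters only through the factor 1 - qⁿ,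
with n the size of T. Dividing by it gives a recursion, but this factor vanishes at q = 1, so the
recursion does not show regularity. -/
theorem existsUnique_isOmegaQ (Om : PLHat ℚ) :
    ∃! Omq : PLHat (RatFunc ℚ), IsOmegaQ Om Omq := by
  set F : PLHat (RatFunc ℚ) → PLHat (RatFunc ℚ) := fun V T =>
    (act (shift RatFunc.X V) (PowerSeries.exp ℚ - 1) (toRatFunc Om) T -
      (preLie (bullet (RatFunc ℚ)) V + (RatFunc.X - 1 : RatFunc ℚ) • bullet (RatFunc ℚ)) T) /
      (1 - RatFunc.X ^ T.size) with hF
  have h1 : ∀ V, IsOmegaQ Om V ↔ F V = V := by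
    intro V
    rw [IsOmegaQ, funext_iff, funext_iff]
    refine forall_congr' fun T => ?_
    rw [hF]
    simp only
    rw [div_eq_iff (one_sub_X_pow_ne_zero T.size_pos), Pi.sub_apply, Pi.add_apply,
      show shift RatFunc.X V T = RatFunc.X ^ T.size * V T from rfl]
    constructor <;> intro h <;> linear_combination h
  have h2 := existsUnique_fixedPoint F (by
    intro A B T h
    have h3 : preLie (bullet (RatFunc ℚ)) A T = preLie (bullet (RatFunc ℚ)) B T :=
      preLie_congr (fun _ _ => rfl) h
    have h4 := act_congr_of_coeff_zero (f := PowerSeries.exp ℚ - 1) (by simp) (toRatFunc Om)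
      (A := shift RatFunc.X A) (A' := shift RatFunc.X B) (T := T)
      (fun S hS => by rw [shift, shift, h S hS])
    rw [hF]
    simp only
    rw [h4, Pi.add_apply, Pi.add_apply, h3])
  simpa only [h1] using h2

end PLHat

-- Identification of Ω_q and specialization at q = 1.

theorem mainTheorem4 :
    (∃! Om : PLHat ℚ, PLHat.IsOmega Om) ∧
    ∀ Om : PLHat ℚ, PLHat.IsOmega Om →
      (∃! Omq : PLHat (RatFunc ℚ), PLHat.IsOmegaQ Om Omq) ∧
      ∀ Omq : PLHat (RatFunc ℚ), PLHat.IsOmegaQ Om Omq →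
        ∀ T : RTree,
          (Omq T).denom.eval 1 ≠ 0 ∧ (Omq T).eval (RingHom.id ℚ) 1 = Om T := by
  refine ⟨PLHat.existsUnique_isOmega, fun Om hOm => ⟨PLHat.existsUnique_isOmegaQ Om, ?_⟩⟩
  obtain ⟨P, hP⟩ := PLHat.exists_isEulerOrbit isUnit_geom_sum_regularX
  set V : PLHat regularAtOne := fun T => (P T).coeff 1 with hV
  have hB : PLHat.act (algebraMap ℚ regularAtOne ∘ Om) PLHat.expDiv
      (algebraMap ℚ regularAtOne ∘ Om) = PLHat.bullet regularAtOne := by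
    rw [← PLHat.map_act, hOm.act_expDiv, PLHat.map_bullet]
  have hX : regularX ≠ 0 := fun h => RatFunc.X_ne_zero (congrArg Subtype.val h)
  have hspec := hP.coeff_one_spec hX (fun n => (isUnit_geom_sum_regularX n).ne_zero) hB
  rw [← hV] at hspec
  set ι : regularAtOne →+* RatFunc ℚ := regularAtOne.val.toRingHom with hι
  have hιB : ι ∘ (algebraMap ℚ regularAtOne ∘ Om) = PLHat.toRatFunc Om := by
    funext T
    simp [hι, PLHat.toRatFunc]
  -- By uniqueness this identifies Ω_q with a series whose coefficients are regular at 1 by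
  -- construction.
  have hVq : PLHat.IsOmegaQ Om (ι ∘ V) := by
    have h1 := PLHat.map_act ι (PLHat.shift regularX V) (PowerSeries.exp ℚ)
      (algebraMap ℚ regularAtOne ∘ Om)
    have h2 := PLHat.map_preLie ι (PLHat.bullet regularAtOne) V
    rw [hspec, hιB, PLHat.map_shift, show ι regularX = RatFunc.X from rfl] at h1
    rw [PLHat.map_bullet] at h2
    rw [PLHat.IsOmegaQ, PLHat.act_sub_one, ← h1, ← h2, ← PLHat.map_bullet ι]
    funext T
    simp only [Pi.add_apply, Pi.sub_apply, Pi.smul_apply, Function.comp_apply, map_add, map_mul,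
      smul_eq_mul, map_sub, map_one, show ι regularX = RatFunc.X from rfl]
    ring
  intro Omq hOmq T
  have hEq : Omq = ι ∘ V := (PLHat.existsUnique_isOmegaQ Om).unique hOmq hVq
  subst hEq
  refine ⟨(V T).2, ?_⟩
  -- The orbit specialized at q = 1 is the orbit over ℚ, whose linear coefficient is Ω.
  have h1 := hP.map evalOne
  rw [evalOne_regularX] at h1
  have h2 := h1.coeff_one_eq hOm.act_expDiv T
  rw [Function.comp_apply, Polynomial.coe_mapRingHom, Polynomial.coeff_map] at h2
  exact h2
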